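/- Conventions. Let $k$ be a field of characteristic different from $2$ and $k\subset\ell$ a quadratic field extension, with conjugation $x\mapsto\overline{x}$ (the non-trivial $k$-automorphism of $\ell$). A $k$-algebra is a $k$-vector space with a $k$-bilinear multiplication, not assumed associative or unital; an algebra $A\neq 0$ is a division algebra if left and right multiplication by every $a\in A\setminus\{0\}$ are bijective. Let $\mathscr{C}(k)$ be the category whose objects are the $4$-dimensional unital division $k$-algebras $A$ such that $k1$ is properly contained in the right nucleus $\{z\in A \mid (xy)z=x(yz)\ \forall x,y\in A\}$ and such that the automorphism group of $A$ has a subgroup isomorphic to Klein's four-group; its morphisms are the non-zero algebra morphisms. Let $\mathscr{N}(k)$ and $\mathscr{S}(k)$ be the full subcategories of $\mathscr{C}(k)$ formed by the non-associative algebras and by the central skew fields over $k$, respectively. For $\underline{c}=(c_1,c_2,c_3)\in k^3$ let $A(\ell,\underline{c})$ be the $k$-algebra $\ell^2$ with product $$\begin{pmatrix}x\\y\end{pmatrix}\cdot\begin{pmatrix}w\\z\end{pmatrix}=\begin{pmatrix}x & c_2y+c_3\overline{y}\\ y & (1-c_1)x+c_1\overline{x}\end{pmatrix}\begin{pmatrix}w\\z\end{pmatrix}.$$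 The triple $\underline{c}$ is $\ell$-admissible if $q_{\underline{c}}(x,y)=(1-c_1)x^2+c_1x\overline{x}-c_2y^2-c_3y\overline{y}$ vanishes on $\ell^2$ only at $(0,0)$. Let $C_\ell$ be the set of $\ell$-admissible triples, $C_\ell^{\mathscr{N}}=\{\underline{c}\in C_\ell\mid A(\ell,\underline{c})\in\mathscr{N}(k)\}$, and let $C_\ell^{\mathscr{N}_0}$ and $C_\ell^{\mathscr{N}_1}$ be the sets of all $\underline{c}\in C_\ell^{\mathscr{N}}$ with $c_2=0$ and with $c_2\neq 0$, respectively. Triples $\underline{c},\underline{d}$ are $\ell^*$-equivalent if $(c_1,c_2/a^2,c_3/(a\overline{a}))=(d_1,d_2,d_3)$ for some $a\in\ell\setminus\{0\}$. Theorem. Let $k$ be a square-ordered field, that is, an ordered field in which the set of squares equals the set of non-negative elements, and let $\ell=k(\sqrt{-1})$. Then the following hold. 1. $\ell$ is a quadratic extension of $k$, and every quadratic extension of $k$ is $k$-isomorphic to $\ell$. 2. The norm map $\ell^*\to k^*$, $a\mapsto a\overline{a}$, is not surjective, and $-1$ is not in its image. 3. $C_\ell=\{(c_1,c_2,c_3)\in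 k^3\mid c_1>\tfrac12,\ c_3<c_2<-c_3\}$. 4. $C_\ell^{\mathscr{N}_0}=\{(c_1,0,c_3)\in k^3\mid c_1>\tfrac12,\ c_3<0,\ c_1\neq1\}$ and $C_\ell^{\mathscr{N}_1}=\{(c_1,c_2,c_3)\in k^3\mid c_1>\tfrac12,\ c_3<c_2<-c_3,\ c_2\neq0\}$. 5. $T^{\mathscr{N}_0}=\{(c_1,0,-1)\mid c_1>\tfrac12,\ c_1\neq1\}$ and $T^{\mathscr{N}_1}=\{(c_1,1,c_3)\mid c_1>\tfrac12,\ c_3<-1\}$ are transversals for the $\ell^*$-equivalence classes of $C_\ell^{\mathscr{N}_0}$ and of $C_\ell^{\mathscr{N}_1}$, respectively, and their disjoint union $T^{\mathscr{N}}=T^{\mathscr{N}_0}\sqcup T^{\mathscr{N}_1}$ is a transversal for the $\ell^*$-equivalence classes of $C_\ell^{\mathscr{N}}$. 6. $(1,0,-1)\notin T^{\mathscr{N}}$, and the algebras $A(\ell,\underline{c})$ with $\underline{c}\in T^{\mathscr{N}}\sqcup\{(1,0,-1)\}$ classify $\mathscr{C}(k)$: they all belong to $\mathscr{C}(k)$,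 they are pairwise non-isomorphic, and every object of $\mathscr{C}(k)$ is isomorphic to one of them. 7. $\mathscr{C}(k)=\mathscr{N}(k)\amalg\mathscr{S}(k)$: the objects of $\mathscr{C}(k)$ are the disjoint union of those of $\mathscr{N}(k)$ and of $\mathscr{S}(k)$, and there are no morphisms in either direction between an object of $\mathscr{N}(k)$ and an object of $\mathscr{S}(k)$. -/

import Mathlib

/-! ### Square-ordered fields and quadratic extensions -/

/-- An ordered field `k` is square-ordered if its set of squares is its set of non-negative
elements. -/
def IsSquareOrdered (k : Type*) [Field k] [LinearOrder k] : Prop :=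
  Set.range (fun x : k => x ^ 2) = {x : k | 0 ≤ x}

/-- `k` has unique quadratic extension class, represented by `ℓ`: the extension `k ⊂ ℓ` is
quadratic and every quadratic extension of `k` is `k`-isomorphic to `ℓ`. -/
def HasUniqueQuadraticExtensionClass.{v, u, w} (k : Type u) (ℓ : Type w) [Field k] [Field ℓ]
    [Algebra k ℓ] : Prop :=
  Module.finrank k ℓ = 2 ∧
    ∀ (m : Type v) [Field m] [Algebra k m], Module.finrank k m = 2 → Nonempty (m ≃ₐ[k] ℓ)

open Classical in
/-- The conjugation `x ↦ x̄` of `ℓ` over `k`: the non-trivial `k`-automorphism of `ℓ`. It exists and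
is unique for a quadratic extension in characteristic zero, see `galConj_spec` (the value `1` in the
absence of non-trivial automorphisms is never used). -/
noncomputable def galConj (k ℓ : Type*) [Field k] [Field ℓ] [Algebra k ℓ] : ℓ ≃ₐ[k] ℓ :=
  if h : ∃ σ : ℓ ≃ₐ[k] ℓ, σ ≠ 1 then h.choose else 1

theorem galConj_spec (k ℓ : Type*) [Field k] [CharZero k] [Field ℓ] [Algebra k ℓ]
    (h : Module.finrank k ℓ = 2) :
    galConj k ℓ ≠ 1 ∧ ∀ σ : ℓ ≃ₐ[k] ℓ, σ ≠ 1 → σ = galConj k ℓ := by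
  have : Algebra.IsQuadraticExtension k ℓ := { finrank_eq_two' := h }
  have : FiniteDimensional k ℓ := FiniteDimensional.of_finrank_pos (by omega)
  have : IsGalois k ℓ := {}
  have hcard : Nat.card (ℓ ≃ₐ[k] ℓ) = 2 := by rw [IsGalois.card_aut_eq_finrank, h]
  obtain ⟨τ, hτ, hu⟩ := (Nat.card_eq_two_iff' (1 : ℓ ≃ₐ[k] ℓ)).1 hcard
  have hex : ∃ σ : ℓ ≃ₐ[k] ℓ, σ ≠ 1 := ⟨τ, hτ⟩
  have hne : galConj k ℓ ≠ 1 := by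
    rw [galConj, dif_pos hex]
    exact hex.choose_spec
  exact ⟨hne, fun σ hσ => (hu σ hσ).trans (hu _ hne).symm⟩

/-- The image in `k` of the norm morphism `ℓ \ {0} → k \ {0}`, `a ↦ a ā`. -/
def normImage (k ℓ : Type*) [Field k] [Field ℓ] [Algebra k ℓ] : Set k :=
  {r : k | ∃ a : ℓ, a ≠ 0 ∧ a * galConj k ℓ a = algebraMap k ℓ r}

/-! ### Not necessarily associative algebras

A `k`-algebra is a `k`-module `A` with a `k`-bilinear multiplication, that is
`[NonUnitalNonAssocRing A] [Module k A] [IsScalarTower k A A] [SMulCommClass k A A]`. -/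

/-- `e` is a unity of `A`. -/
def IsUnity {A : Type*} [Mul A] (e : A) : Prop :=
  ∀ x : A, e * x = x ∧ x * e = x

/-- `A` is a division algebra: it is non-zero, and left and right multiplication by any non-zero
element are bijective. -/
def IsDivisionAlg (A : Type*) [NonUnitalNonAssocRing A] : Prop :=
  Nontrivial A ∧ ∀ a : A, a ≠ 0 →
    Function.Bijective (fun x : A => a * x) ∧ Function.Bijective (fun x : A => x * a)

/-- The right nucleus of `A`. -/
def rightNucleus (A : Type*) [Mul A] : Set A :=
  {z : A | ∀ x y : A, (x * y) * z = x * (y * z)}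

/-- The automorphism group of the `k`-algebra `A`, inside the group of linear automorphisms. -/
def algAut (k A : Type*) [Field k] [NonUnitalNonAssocRing A] [Module k A] :
    Subgroup (A ≃ₗ[k] A) where
  carrier := {φ | ∀ x y : A, φ (x * y) = φ x * φ y}
  mul_mem' := by
    intro φ ψ hφ hψ x y
    have hφ' : ∀ x y : A, φ (x * y) = φ x * φ y := hφ
    have hψ' : ∀ x y : A, ψ (x * y) = ψ x * ψ y := hψ
    simp [LinearEquiv.mul_apply, hφ', hψ']
  one_mem' := by
    intro x y
    rfl
  inv_mem' := by
    intro φ hφ x y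
    have hφ' : ∀ x y : A, φ (x * y) = φ x * φ y := hφ
    apply φ.injective
    rw [hφ']
    change φ (φ.symm _) = φ (φ.symm _) * φ (φ.symm _)
    simp

/-- `A` and `B` are isomorphic `k`-algebras. -/
def AlgIsomorphic (k A B : Type*) [Field k] [NonUnitalNonAssocRing A] [Module k A]
    [NonUnitalNonAssocRing B] [Module k B] : Prop :=
  ∃ φ : A ≃ₗ[k] B, ∀ x y : A, φ (x * y) = φ x * φ y

/-- `A` is an object of `𝒞(k)`: a 4-dimensional unital division algebra over `k`, such that
`k1` is properly contained in the right nucleus and the automorphism group has a subgroup that is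
Klein's four-group. -/
structure IsC (k A : Type*) [Field k] [NonUnitalNonAssocRing A] [Module k A]
    [IsScalarTower k A A] [SMulCommClass k A A] : Prop where
  finrank_eq_four : Module.finrank k A = 4
  division : IsDivisionAlg A
  nucleus : ∃ e : A, IsUnity e ∧ Set.range (fun r : k => r • e) ⊂ rightNucleus A
  klein : ∃ H : Subgroup (algAut k A), IsKleinFour H

/-- `A` is an object of `𝒩(k)`: an object of `𝒞(k)` that is not associative. -/
def IsN (k A : Type*) [Field k] [NonUnitalNonAssocRing A] [Module k A]
    [IsScalarTower k A A] [SMulCommClass k A A] : Prop :=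
  IsC k A ∧ ¬ ∀ x y z : A, (x * y) * z = x * (y * z)

/-- `A` is an object of `𝒮(k)`: an object of `𝒞(k)` that is a central skew field over `k`, that is,
associative with centre `k1`. -/
def IsS (k A : Type*) [Field k] [NonUnitalNonAssocRing A] [Module k A]
    [IsScalarTower k A A] [SMulCommClass k A A] : Prop :=
  IsC k A ∧ (∀ x y z : A, (x * y) * z = x * (y * z)) ∧
    ∃ e : A, IsUnity e ∧ {z : A | ∀ x : A, z * x = x * z} = Set.range (fun r : k => r • e)

/-! ### The algebras `A(ℓ, c)` -/

section TripleAlg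

variable (k ℓ : Type*) [Field k] [Field ℓ] [Algebra k ℓ]

/-- The function `q_c(x, y) = (1 - c₁) x² + c₁ x x̄ - c₂ y² - c₃ y ȳ` on `ℓ²`, for the triple
`c = (c₁, c₂, c₃)`. -/
noncomputable def qForm (c : k × k × k) (p : ℓ × ℓ) : ℓ :=
  algebraMap k ℓ (1 - c.1) * p.1 ^ 2 + algebraMap k ℓ c.1 * (p.1 * galConj k ℓ p.1)
    - algebraMap k ℓ c.2.1 * p.2 ^ 2 - algebraMap k ℓ c.2.2 * (p.2 * galConj k ℓ p.2)

/-- The set `C_ℓ` of `ℓ`-admissible triples: those `c` for which `q_c` is anisotropic. -/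
def admissible : Set (k × k × k) :=
  {c | qForm k ℓ c ⁻¹' {0} = {(0, 0)}}

/-- The underlying vector space `ℓ²` of the algebra `A(ℓ, c)`. -/
def TripleAlg (_c : k × k × k) : Type _ := ℓ × ℓ

variable (c : k × k × k)

instance : AddCommGroup (TripleAlg k ℓ c) := inferInstanceAs (AddCommGroup (ℓ × ℓ))

instance : Module k (TripleAlg k ℓ c) := inferInstanceAs (Module k (ℓ × ℓ))

/-- The product `(x, y) · (w, z)` in `A(ℓ, c)`: the matrix with rows
`(x, c₂ y + c₃ ȳ)` and `(y, (1 - c₁) x + c₁ x̄)`, applied to the column `(w, z)`. -/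
noncomputable def TripleAlg.mul (p q : ℓ × ℓ) : ℓ × ℓ :=
  (p.1 * q.1 + (algebraMap k ℓ c.2.1 * p.2 + algebraMap k ℓ c.2.2 * galConj k ℓ p.2) * q.2,
   p.2 * q.1 + (algebraMap k ℓ (1 - c.1) * p.1 + algebraMap k ℓ c.1 * galConj k ℓ p.1) * q.2)

theorem TripleAlg.mul_add (p q r : ℓ × ℓ) :
    TripleAlg.mul k ℓ c p (q + r) = TripleAlg.mul k ℓ c p q + TripleAlg.mul k ℓ c p r := by
  ext <;> simp [TripleAlg.mul] <;> ring

theorem TripleAlg.add_mul (p q r : ℓ × ℓ) :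
    TripleAlg.mul k ℓ c (p + q) r = TripleAlg.mul k ℓ c p r + TripleAlg.mul k ℓ c q r := by
  ext <;> simp [TripleAlg.mul] <;> ring

theorem TripleAlg.smul_mul (r : k) (p q : ℓ × ℓ) :
    TripleAlg.mul k ℓ c (r • p) q = r • TripleAlg.mul k ℓ c p q := by
  ext <;> simp [TripleAlg.mul, Algebra.smul_def] <;> ring

theorem TripleAlg.mul_smul (r : k) (p q : ℓ × ℓ) :
    TripleAlg.mul k ℓ c p (r • q) = r • TripleAlg.mul k ℓ c p q := by
  ext <;> simp [TripleAlg.mul, Algebra.smul_def] <;> ring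

noncomputable instance : Mul (TripleAlg k ℓ c) := ⟨TripleAlg.mul k ℓ c⟩

noncomputable instance : NonUnitalNonAssocRing (TripleAlg k ℓ c) :=
  { (inferInstance : AddCommGroup (TripleAlg k ℓ c)),
    (inferInstance : Mul (TripleAlg k ℓ c)) with
    left_distrib := TripleAlg.mul_add k ℓ c
    right_distrib := TripleAlg.add_mul k ℓ c
    zero_mul := fun p => by
      have h := TripleAlg.smul_mul k ℓ c 0 (0 : ℓ × ℓ) p
      rw [zero_smul, zero_smul] at h
      exact h
    mul_zero := fun p => by
      have h := TripleAlg.mul_smul k ℓ c 0 p (0 : ℓ × ℓ)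
      rw [zero_smul, zero_smul] at h
      exact h }

instance : IsScalarTower k (TripleAlg k ℓ c) (TripleAlg k ℓ c) where
  smul_assoc := TripleAlg.smul_mul k ℓ c

instance : SMulCommClass k (TripleAlg k ℓ c) (TripleAlg k ℓ c) where
  smul_comm := fun r p q => (TripleAlg.mul_smul k ℓ c r p q).symm

/-- The set `C_ℓ^𝒩` of all `ℓ`-admissible `c` with `A(ℓ, c)` in `𝒩(k)`. -/
def admissibleN : Set (k × k × k) :=
  {c | c ∈ admissible k ℓ ∧ IsN k (TripleAlg k ℓ c)}

/-- The subset of all `c` in `C_ℓ^𝒩` with `c₂ = 0`. -/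
def admissibleN0 : Set (k × k × k) := {c | c ∈ admissibleN k ℓ ∧ c.2.1 = 0}

/-- The subset of all `c` in `C_ℓ^𝒩` with `c₂ ≠ 0`. -/
def admissibleN1 : Set (k × k × k) := {c | c ∈ admissibleN k ℓ ∧ c.2.1 ≠ 0}

/-- `ℓ*`-equivalence of triples: for some `a` in `ℓ*` one has
`(c₁, c₂ / a², c₃ / (a ā)) = (d₁, d₂, d₃)`. -/
def StarEquiv (c d : k × k × k) : Prop :=
  ∃ a : ℓ, a ≠ 0 ∧ c.1 = d.1 ∧
    algebraMap k ℓ c.2.1 / a ^ 2 = algebraMap k ℓ d.2.1 ∧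
    algebraMap k ℓ c.2.2 / (a * galConj k ℓ a) = algebraMap k ℓ d.2.2

/-- `ℓ*`-equivalence is an equivalence relation. -/
theorem starEquiv_equivalence : Equivalence (StarEquiv k ℓ) where
  refl c := ⟨1, by simp⟩
  symm := by
    rintro c d ⟨a, ha, h1, h2, h3⟩
    have ha' : galConj k ℓ a ≠ 0 := by simpa using ha
    refine ⟨a⁻¹, inv_ne_zero ha, h1.symm, ?_, ?_⟩
    · rw [← h2]; field_simp
    · rw [← h3, map_inv₀]; field_simp
  trans := by
    rintro c d e ⟨a, ha, h1, h2, h3⟩ ⟨b, hb, g1, g2, g3⟩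
    refine ⟨a * b, mul_ne_zero ha hb, h1.trans g1, ?_, ?_⟩
    · rw [← g2, ← h2, mul_pow, div_div]
    · rw [← g3, ← h3, map_mul, div_div]
      congr 1
      ring

/-- `T` is a transversal for the `ℓ*`-equivalence classes of `C`: a subset of `C` that contains
exactly one member of each class. -/
def IsStarTransversal (C T : Set (k × k × k)) : Prop :=
  T ⊆ C ∧ ∀ c ∈ C, ∃! t, t ∈ T ∧ StarEquiv k ℓ c t

/-- The algebras `A(ℓ, c)`, `c ∈ T`, classify `𝒞(k)`: they are pairwise non-isomorphic objects of
`𝒞(k)`, and every object of `𝒞(k)` is isomorphic to one of them. -/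
def ClassifiesC.{v, u, w} (k : Type u) (ℓ : Type w) [Field k] [Field ℓ] [Algebra k ℓ]
    (T : Set (k × k × k)) : Prop :=
  (∀ c ∈ T, IsC k (TripleAlg k ℓ c)) ∧
  (∀ c ∈ T, ∀ d ∈ T, AlgIsomorphic k (TripleAlg k ℓ c) (TripleAlg k ℓ d) → c = d) ∧
  ∀ (A : Type v) [NonUnitalNonAssocRing A] [Module k A] [IsScalarTower k A A]
    [SMulCommClass k A A], IsC k A → ∃ c ∈ T, AlgIsomorphic k (TripleAlg k ℓ c) A

end TripleAlg

/-- `𝒞(k) = 𝒩(k) ⨿ 𝒮(k)`: an algebra is in `𝒞(k)` if and only if it is in exactly one of `𝒩(k)` and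
`𝒮(k)`, and there are no morphisms, i.e. non-zero algebra morphisms, between objects of
`𝒩(k)` and objects of `𝒮(k)`. -/
def CEqNCoprodS.{v, u} (k : Type u) [Field k] : Prop :=
  (∀ (A : Type v) [NonUnitalNonAssocRing A] [Module k A] [IsScalarTower k A A]
    [SMulCommClass k A A], IsC k A ↔ (IsN k A ∨ IsS k A) ∧ ¬ (IsN k A ∧ IsS k A)) ∧
  ∀ (A B : Type v) [NonUnitalNonAssocRing A] [Module k A] [IsScalarTower k A A]
    [SMulCommClass k A A] [NonUnitalNonAssocRing B] [Module k B] [IsScalarTower k B B]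
    [SMulCommClass k B B], IsN k A → IsS k B →
      (∀ φ : A →ₙₐ[k] B, φ = 0) ∧ (∀ φ : B →ₙₐ[k] A, φ = 0)

/-- The set of all triples `(c₁, 0, -1)` with `c₁ > 1/2` and `c₁ ≠ 1`. -/
def transversalN0 (k : Type*) [Field k] [LinearOrder k] : Set (k × k × k) :=
  {c | 1 / 2 < c.1 ∧ c.1 ≠ 1 ∧ c.2.1 = 0 ∧ c.2.2 = -1}

/-- The set of all triples `(c₁, 1, c₃)` with `c₁ > 1/2` and `c₃ < -1`. -/
def transversalN1 (k : Type*) [Field k] [LinearOrder k] : Set (k × k × k) :=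
  {c | 1 / 2 < c.1 ∧ c.2.1 = 1 ∧ c.2.2 < -1}

universe v u w

/-! ### The quadratic extension `ℓ = k ⊕ k i`, its conjugation and its norm. -/

section Quadratic

variable {k : Type*} [Field k] [LinearOrder k] [IsStrictOrderedRing k]

/-! Left multiplication by `p` in `A(ℓ, c)` is `ℓ`-linear with determinant `q_c(p)`, so being a
division algebra amounts to admissibility (`TripleAlg.isDivisionAlg_iff`). In coordinates over `1,
i` the `k`-part of `q_c` is a diagonal quadratic form, and admissibility amounts to positivity of
its coefficients (`IsSquareOrdered.mem_admissible_iff_lt`). Conjugation and a sign change on the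
second coordinate generate a Klein four-group, and `ℓ × 0` lies in the right nucleus, so every
admissible triple yields an object of `𝒞(k)` (`TripleAlg.isC`).

Conversely, the Klein four-group of an object `A` splits it into four lines, one for each character,
and products of eigenvectors follow products of characters. The right nucleus is invariant, so it
contains a non-scalar eigenvector `u`. Its square is a negative scalar, which can be scaled to `-1`;
this gives a copy of `ℓ` in the right nucleus. With an eigenvector `v` of another non-trivial
character, `A = ℓ ⊕ vℓ`, and three scalars, equivalent to a triple `c`, determine the product
(`IsC.exists_algIsomorphic`).

For non-associative algebras the right nucleus is exactly `ℓ × 0`. An isomorphism therefore induces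
an automorphism of `ℓ`, and comparing products forces `ℓ*`-equivalence
(`TripleAlg.starEquiv_of_algIsomorphic`). Rescaling by square roots supplies unique normal forms;
the associative ones reduce to `(1, 0, -1)`. Non-zero morphisms in `𝒞(k)` are isomorphisms, hence
respect associativity. -/

omit [IsStrictOrderedRing k] in
theorem IsSquareOrdered.exists_sq (hk : IsSquareOrdered k) {x : k} (hx : 0 ≤ x) :
    ∃ y : k, y ^ 2 = x := by
  have : x ∈ Set.range (fun x : k => x ^ 2) := by
    rw [show Set.range (fun x : k => x ^ 2) = _ from hk]; exact hx
  exact this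

theorem IsSquareOrdered.exists_pos_sq (hk : IsSquareOrdered k) {x : k} (hx : 0 < x) :
    ∃ y : k, 0 < y ∧ y ^ 2 = x := by
  obtain ⟨y, rfl⟩ := hk.exists_sq hx.le
  exact ⟨|y|, abs_pos.2 (by rintro rfl; simp at hx), sq_abs y⟩

variable {ℓ : Type*} [Field ℓ] [Algebra k ℓ] {i : ℓ}

theorem algebraMap_ne_of_sq_eq_neg_one (hi : i ^ 2 = -1) (a : k) : algebraMap k ℓ a ≠ i := by
  rintro rfl
  rw [← map_pow, ← map_one (algebraMap k ℓ), ← map_neg] at hi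
  have := (algebraMap k ℓ).injective hi
  nlinarith [sq_nonneg a]

theorem linearIndependent_one_sqrt (hi : i ^ 2 = -1) : LinearIndependent k ![1, i] := by
  rw [LinearIndependent.pair_iff' one_ne_zero]
  intro a
  rw [← Algebra.algebraMap_eq_smul_one]
  exact algebraMap_ne_of_sq_eq_neg_one hi a

theorem exists_eq_add_mul_sqrt (h2 : Module.finrank k ℓ = 2) (hi : i ^ 2 = -1) (x : ℓ) :
    ∃ a b : k, x = algebraMap k ℓ a + algebraMap k ℓ b * i := by
  have := (linearIndependent_one_sqrt (k := k) hi).span_eq_top_of_card_eq_finrank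
    (by rw [h2, Fintype.card_fin])
  have hx : x ∈ Submodule.span k (Set.range ![1, i]) := this ▸ Submodule.mem_top
  rw [Matrix.range_cons, Matrix.range_cons, Matrix.range_empty, Set.union_empty,
    Set.singleton_union, Submodule.mem_span_pair] at hx
  obtain ⟨a, b, rfl⟩ := hx
  exact ⟨a, b, by simp [Algebra.smul_def]⟩

theorem add_mul_sqrt_eq_zero (hi : i ^ 2 = -1) {a b : k}
    (h : algebraMap k ℓ a + algebraMap k ℓ b * i = 0) : a = 0 ∧ b = 0 := by
  have hli := linearIndependent_one_sqrt (k := k) hi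
  rw [LinearIndependent.pair_iff] at hli
  exact hli a b (by simpa [Algebra.smul_def] using h)

theorem exists_linearMap_of_sqrt (h2 : Module.finrank k ℓ = 2) (hi : i ^ 2 = -1)
    {M : Type*} [AddCommGroup M] [Module k M] (m n : M) :
    ∃ f : ℓ →ₗ[k] M, f 1 = m ∧ f i = n := by
  have hli := linearIndependent_one_sqrt (k := k) hi
  let b := basisOfLinearIndependentOfCardEqFinrank hli (by rw [h2, Fintype.card_fin])
  have h0 : b 0 = 1 := by simp [b]
  have h1 : b 1 = i := by simp [b]
  refine ⟨b.constr k ![m, n], ?_, ?_⟩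
  · rw [← h0, Module.Basis.constr_basis]; rfl
  · rw [← h1, Module.Basis.constr_basis]; rfl

/-- The minimal polynomial of `i` divides `X ^ 2 + 1` and is not linear, because `-1` is not a
square in an ordered field. -/
theorem finrank_eq_two_of_adjoin_sqrt (hi : i ^ 2 = -1)
    (hℓ : IntermediateField.adjoin k {i} = ⊤) : Module.finrank k ℓ = 2 := by
  have hmonic : (Polynomial.X ^ 2 + 1 : Polynomial k).Monic := by
    simpa using Polynomial.monic_X_pow_add_C (1 : k) two_ne_zero
  have hdeg : (Polynomial.X ^ 2 + 1 : Polynomial k).natDegree = 2 := by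
    simpa using Polynomial.natDegree_X_pow_add_C (n := 2) (r := (1 : k))
  have hroot : Polynomial.aeval i (Polynomial.X ^ 2 + 1 : Polynomial k) = 0 := by simp [hi]
  have hint : IsIntegral k i := ⟨_, hmonic, by simpa [Polynomial.aeval_def] using hroot⟩
  have hfr := IntermediateField.adjoin.finrank hint
  rw [hℓ, IntermediateField.finrank_top'] at hfr
  rw [hfr]
  apply le_antisymm
  · rw [← hdeg]
    exact Polynomial.natDegree_le_of_dvd (minpoly.dvd k i hroot) hmonic.ne_zero
  · rw [minpoly.two_le_natDegree_iff hint]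
    rintro ⟨a, ha⟩
    exact algebraMap_ne_of_sq_eq_neg_one hi a ha

theorem nonempty_algEquiv_of_sqrt {m : Type*} [Field m] [Algebra k m]
    (h2 : Module.finrank k ℓ = 2) (hi : i ^ 2 = -1) (hm : Module.finrank k m = 2) {j : m}
    (hj : j ^ 2 = -1) : Nonempty (m ≃ₐ[k] ℓ) := by
  obtain ⟨f, f1, fj⟩ := exists_linearMap_of_sqrt hm hj (1 : ℓ) i
  have hf : ∀ a b : k, f (algebraMap k m a + algebraMap k m b * j) =
      algebraMap k ℓ a + algebraMap k ℓ b * i := by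
    intro a b
    rw [map_add, Algebra.algebraMap_eq_smul_one, map_smul, f1, ← Algebra.smul_def, map_smul, fj,
      Algebra.smul_def, Algebra.smul_def, mul_one]
  have hmul : ∀ x y, f (x * y) = f x * f y := by
    intro x y
    obtain ⟨a, b, rfl⟩ := exists_eq_add_mul_sqrt hm hj x
    obtain ⟨c, d, rfl⟩ := exists_eq_add_mul_sqrt hm hj y
    rw [show (algebraMap k m a + algebraMap k m b * j) * (algebraMap k m c + algebraMap k m d * j)
      = algebraMap k m (a * c - b * d) + algebraMap k m (a * d + b * c) * j by
        simp only [map_add, map_sub, map_mul]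
        linear_combination (algebraMap k m b * algebraMap k m d) * hj, hf, hf, hf]
    simp only [map_add, map_sub, map_mul]
    linear_combination (- algebraMap k ℓ b * algebraMap k ℓ d) * hi
  let g : m →ₐ[k] ℓ := AlgHom.ofLinearMap f f1 hmul
  have : FiniteDimensional k m := FiniteDimensional.of_finrank_pos (by omega)
  have : FiniteDimensional k ℓ := FiniteDimensional.of_finrank_pos (by omega)
  have hg : Function.Injective g := g.toRingHom.injective
  exact ⟨AlgEquiv.ofBijective g ⟨hg,
    (LinearMap.injective_iff_surjective_of_finrank_eq_finrank (f := g.toLinearMap)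
      (hm.trans h2.symm)).1 hg⟩⟩

/-- Completing the square for a generator `x` yields an element whose square is the discriminant. A
non-negative discriminant would be a square in `k` and put `x` into `k`; a negative one becomes `-1`
after scaling by the root of its opposite. -/
theorem IsSquareOrdered.exists_sqrt_neg_one (hk : IsSquareOrdered k)
    (h2 : Module.finrank k ℓ = 2) : ∃ j : ℓ, j ^ 2 = -1 := by
  have hx : ∃ x : ℓ, ∀ a : k, algebraMap k ℓ a ≠ x := by
    by_contra! h
    have hs : Function.Surjective (Algebra.linearMap k ℓ) := h
    have := (Algebra.linearMap k ℓ).finrank_range_le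
    rw [LinearMap.range_eq_top.2 hs, finrank_top] at this
    rw [h2, Module.finrank_self] at this
    omega
  obtain ⟨x, hx⟩ := hx
  have hli : LinearIndependent k ![1, x] := by
    rw [LinearIndependent.pair_iff' one_ne_zero]
    intro a
    rw [← Algebra.algebraMap_eq_smul_one]
    exact hx a
  have := hli.span_eq_top_of_card_eq_finrank (by rw [h2, Fintype.card_fin])
  have hxx : x ^ 2 ∈ Submodule.span k (Set.range ![1, x]) := this ▸ Submodule.mem_top
  rw [Matrix.range_cons, Matrix.range_cons, Matrix.range_empty, Set.union_empty,
    Set.singleton_union, Submodule.mem_span_pair] at hxx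
  obtain ⟨a, b, hab⟩ := hxx
  simp only [Algebra.smul_def, mul_one] at hab
  have hsq : (2 * x - algebraMap k ℓ b) ^ 2 = algebraMap k ℓ (4 * a + b ^ 2) := by
    simp only [map_add, map_mul, map_pow, map_ofNat]
    linear_combination (-4) * hab
  have h20 : (2 : ℓ) = algebraMap k ℓ 2 := (map_ofNat _ 2).symm
  have h2k : algebraMap k ℓ 2 ≠ 0 := (map_ne_zero _).2 two_ne_zero
  by_cases hD : 0 ≤ 4 * a + b ^ 2
  · exfalso
    obtain ⟨r, hr⟩ := hk.exists_sq hD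
    rw [← hr, map_pow, sq_eq_sq_iff_eq_or_eq_neg] at hsq
    rcases hsq with h | h
    · refine hx ((b + r) / 2) ?_
      rw [map_div₀, div_eq_iff h2k, map_add]
      linear_combination (-1 : ℓ) * h + x * h20
    · refine hx ((b - r) / 2) ?_
      rw [map_div₀, div_eq_iff h2k, map_sub]
      linear_combination (-1 : ℓ) * h + x * h20
  · obtain ⟨r, hr0, hr⟩ := hk.exists_pos_sq (x := -(4 * a + b ^ 2)) (by linarith)
    refine ⟨(2 * x - algebraMap k ℓ b) / algebraMap k ℓ r, ?_⟩
    have : algebraMap k ℓ r ≠ 0 := by simpa using hr0.ne'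
    rw [div_pow, hsq, ← map_pow, hr, map_neg, div_neg, div_self]
    have : 4 * a + b ^ 2 ≠ 0 := by intro h; apply hD; rw [h]
    exact (map_ne_zero _).2 this

theorem hasUniqueQuadraticExtensionClass_of_sqrt.{a, b, c} {k : Type b} [Field k] [LinearOrder k]
    [IsStrictOrderedRing k] {ℓ : Type c} [Field ℓ] [Algebra k ℓ] {i : ℓ}
    (hk : IsSquareOrdered k) (h2 : Module.finrank k ℓ = 2)
    (hi : i ^ 2 = -1) : HasUniqueQuadraticExtensionClass.{a} k ℓ := by
  refine ⟨h2, fun m _ _ hm => ?_⟩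
  obtain ⟨j, hj⟩ := hk.exists_sqrt_neg_one hm
  exact nonempty_algEquiv_of_sqrt h2 hi hm hj

theorem galConj_sqrt (h2 : Module.finrank k ℓ = 2) (hi : i ^ 2 = -1) : galConj k ℓ i = -i := by
  have h : galConj k ℓ i ^ 2 = i ^ 2 := by rw [← map_pow, hi, map_neg, map_one]
  rcases sq_eq_sq_iff_eq_or_eq_neg.1 h with h | h
  -- Fixing `i` would make the conjugation trivial on `k ⊕ k i`.
  · refine absurd ?_ (galConj_spec k ℓ h2).1
    ext x
    obtain ⟨a, b, rfl⟩ := exists_eq_add_mul_sqrt h2 hi x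
    simp [h]
  · exact h

theorem galConj_add_mul_sqrt (h2 : Module.finrank k ℓ = 2) (hi : i ^ 2 = -1) (a b : k) :
    galConj k ℓ (algebraMap k ℓ a + algebraMap k ℓ b * i) =
      algebraMap k ℓ a - algebraMap k ℓ b * i := by
  simp [galConj_sqrt h2 hi, sub_eq_add_neg]

theorem galConj_galConj (h2 : Module.finrank k ℓ = 2) (hi : i ^ 2 = -1) (x : ℓ) :
    galConj k ℓ (galConj k ℓ x) = x := by
  obtain ⟨a, b, rfl⟩ := exists_eq_add_mul_sqrt h2 hi x
  simp [galConj_sqrt h2 hi]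

theorem exists_mul_galConj (h2 : Module.finrank k ℓ = 2) (hi : i ^ 2 = -1) {x : ℓ} (hx : x ≠ 0) :
    ∃ r : k, 0 < r ∧ x * galConj k ℓ x = algebraMap k ℓ r := by
  obtain ⟨a, b, rfl⟩ := exists_eq_add_mul_sqrt h2 hi x
  refine ⟨a ^ 2 + b ^ 2, ?_, ?_⟩
  · rcases eq_or_ne a 0 with rfl | ha
    · have : b ≠ 0 := by rintro rfl; simp at hx
      positivity
    · positivity
  · rw [galConj_add_mul_sqrt h2 hi]
    simp only [map_add, map_pow]
    linear_combination (- algebraMap k ℓ b ^ 2) * hi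

theorem neg_one_notMem_normImage (h2 : Module.finrank k ℓ = 2) (hi : i ^ 2 = -1) :
    (-1 : k) ∉ normImage k ℓ := by
  rintro ⟨x, hx, h⟩
  obtain ⟨r, hr, h'⟩ := exists_mul_galConj h2 hi hx
  rw [h'] at h
  have := (algebraMap k ℓ).injective h
  linarith

/-! ### Admissibility as a system of inequalities. -/

theorem qForm_add_mul_sqrt (h2 : Module.finrank k ℓ = 2) (hi : i ^ 2 = -1) (c : k × k × k)
    (a b p q : k) :
    qForm k ℓ c (algebraMap k ℓ a + algebraMap k ℓ b * i, algebraMap k ℓ p + algebraMap k ℓ q * i) =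
      algebraMap k ℓ (a ^ 2 + (2 * c.1 - 1) * b ^ 2 - (c.2.1 + c.2.2) * p ^ 2
        + (c.2.1 - c.2.2) * q ^ 2) +
      algebraMap k ℓ (2 * (1 - c.1) * a * b - 2 * c.2.1 * p * q) * i := by
  simp only [qForm, galConj_add_mul_sqrt h2 hi]
  simp only [map_add, map_sub, map_mul, map_pow, map_one, map_ofNat]
  linear_combination ((1 - 2 * algebraMap k ℓ c.1) * algebraMap k ℓ b ^ 2 -
    (algebraMap k ℓ c.2.1 - algebraMap k ℓ c.2.2) * algebraMap k ℓ q ^ 2) * hi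

omit [LinearOrder k] [IsStrictOrderedRing k] in
theorem mem_admissible_iff {c : k × k × k} :
    c ∈ admissible k ℓ ↔ ∀ p : ℓ × ℓ, qForm k ℓ c p = 0 → p = 0 := by
  refine ⟨fun h p hp => ?_, fun h => Set.ext fun p => ⟨h p, ?_⟩⟩
  · have : p ∈ qForm k ℓ c ⁻¹' {0} := hp
    rw [show qForm k ℓ c ⁻¹' {0} = _ from h] at this
    exact this
  · rintro rfl
    simp [qForm]

theorem IsSquareOrdered.exists_isotropic (hk : IsSquareOrdered k) {r s : k}
    (h : r ≤ 0 ∧ 0 ≤ s ∨ 0 ≤ r ∧ s ≤ 0) : ∃ x y : k, (x ≠ 0 ∨ y ≠ 0) ∧ r * x ^ 2 + s * y ^ 2 = 0 := by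
  rcases eq_or_ne r 0 with rfl | hr
  · exact ⟨1, 0, by simp, by simp⟩
  · have : 0 ≤ -r * s := by rcases h with h | h <;> nlinarith
    obtain ⟨t, ht⟩ := hk.exists_sq this
    exact ⟨t, r, Or.inr hr, by rw [ht]; ring⟩

/-- If the inequalities hold, the `k`-part of `q_c` is positive definite and the coefficient of `i`
plays no role. For the converse, `q_c` is restricted to coordinate planes on which the coefficient
of `i` vanishes; there a binary diagonal form must be anisotropic, so its coefficients have the same
strict sign. -/
theorem IsSquareOrdered.mem_admissible_iff_lt (hk : IsSquareOrdered k)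
    (h2 : Module.finrank k ℓ = 2) (hi : i ^ 2 = -1) {c : k × k × k} :
    c ∈ admissible k ℓ ↔ 1 / 2 < c.1 ∧ c.2.2 < c.2.1 ∧ c.2.1 < -c.2.2 := by
  rw [mem_admissible_iff]
  constructor
  · intro h
    have key : ∀ a b p q : k, a ^ 2 + (2 * c.1 - 1) * b ^ 2 - (c.2.1 + c.2.2) * p ^ 2
        + (c.2.1 - c.2.2) * q ^ 2 = 0 → 2 * (1 - c.1) * a * b - 2 * c.2.1 * p * q = 0 →
        a = 0 ∧ b = 0 ∧ p = 0 ∧ q = 0 := by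
      intro a b p q h3 h4
      have := h _ (by rw [qForm_add_mul_sqrt h2 hi c a b p q, h3, h4]; simp)
      rw [Prod.mk_eq_zero] at this
      exact ⟨(add_mul_sqrt_eq_zero hi this.1).1, (add_mul_sqrt_eq_zero hi this.1).2,
        (add_mul_sqrt_eq_zero hi this.2).1, (add_mul_sqrt_eq_zero hi this.2).2⟩
    have hp : c.2.1 + c.2.2 < 0 := by
      by_contra! h5
      obtain ⟨x, y, hxy, h0⟩ := hk.exists_isotropic (r := 1) (s := -(c.2.1 + c.2.2))
        (Or.inr ⟨zero_le_one, by linarith⟩)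
      have := key x 0 y 0 (by linear_combination h0) (by ring)
      tauto
    have hq : 0 < c.2.1 - c.2.2 := by
      by_contra! h5
      obtain ⟨x, y, hxy, h0⟩ := hk.exists_isotropic (r := 1) (s := c.2.1 - c.2.2)
        (Or.inr ⟨zero_le_one, by linarith⟩)
      have := key x 0 0 y (by linear_combination h0) (by ring)
      tauto
    -- The plane of `b` and `q` is used, since in the plane of `a` and `b` the coefficient of `i`
    -- need not vanish.
    have hb : 0 < 2 * c.1 - 1 := by
      by_contra! h5
      obtain ⟨x, y, hxy, h0⟩ := hk.exists_isotropic (r := 2 * c.1 - 1) (s := c.2.1 - c.2.2)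
        (Or.inl ⟨h5, hq.le⟩)
      have := key 0 x 0 y (by linear_combination h0) (by ring)
      tauto
    refine ⟨by linarith, by linarith, by linarith⟩
  · rintro ⟨h1, h3, h4⟩ ⟨x, y⟩ h
    obtain ⟨a, b, rfl⟩ := exists_eq_add_mul_sqrt h2 hi x
    obtain ⟨p, q, rfl⟩ := exists_eq_add_mul_sqrt h2 hi y
    rw [qForm_add_mul_sqrt h2 hi] at h
    have h := (add_mul_sqrt_eq_zero hi h).1
    have hb : 0 < 2 * c.1 - 1 := by linarith
    have hp : 0 < -(c.2.1 + c.2.2) := by linarith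
    have hq : 0 < c.2.1 - c.2.2 := by linarith
    have zero_of : ∀ {r x : k}, 0 < r → r * x ^ 2 ≤ 0 → x = 0 := by
      intro r x hr hx
      by_contra hx0
      have : 0 < r * x ^ 2 := by positivity
      linarith
    have ta : 0 ≤ a ^ 2 := sq_nonneg a
    have tb := mul_nonneg hb.le (sq_nonneg b)
    have tp := mul_nonneg hp.le (sq_nonneg p)
    have tq := mul_nonneg hq.le (sq_nonneg q)
    have a0 : a = 0 := zero_of one_pos (by linarith)
    have b0 : b = 0 := zero_of hb (by linarith)
    have p0 : p = 0 := zero_of hp (by linarith)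
    have q0 : q = 0 := zero_of hq (by linarith)
    simp [a0, b0, p0, q0]

end Quadratic

/-! ### Klein four-groups from two commuting involutions. -/

section Klein

theorem exists_isKleinFour {G : Type*} [Group G] {s t : G} (hs : s * s = 1) (ht : t * t = 1)
    (hst : s * t = t * s) (hs1 : s ≠ 1) (ht1 : t ≠ 1) (hne : s ≠ t) :
    ∃ H : Subgroup G, IsKleinFour H := by
  have hst1 : s * t ≠ 1 := fun h => hne (by rw [← mul_left_inj t, h, ht])
  have e1 : s * (s * t) = t := by rw [← mul_assoc, hs, one_mul]
  have e2 : t * (s * t) = s := by rw [hst, ← mul_assoc, ht, one_mul]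
  have e3 : s * t * s = t := by rw [hst, mul_assoc, hs, mul_one]
  have e4 : s * t * t = s := by rw [mul_assoc, ht, mul_one]
  have e5 : s * t * (s * t) = 1 := by rw [← mul_assoc, e3, ht]
  let H : Subgroup G :=
    { carrier := {1, s, t, s * t}
      one_mem' := by simp
      mul_mem' := by
        rintro a b (rfl | rfl | rfl | rfl) (rfl | rfl | rfl | rfl) <;>
          simp [hs, ht, e1, e2, e3, e4, e5, ← hst]
      inv_mem' := by
        rintro a (rfl | rfl | rfl | rfl)
        · simp
        · simp [inv_eq_of_mul_eq_one_left hs]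
        · simp [inv_eq_of_mul_eq_one_left ht]
        · rw [inv_eq_of_mul_eq_one_left e5]; simp }
  have hsq : ∀ x : H, x ^ 2 = 1 := by
    rintro ⟨x, hx⟩
    apply Subtype.ext
    rcases hx with rfl | rfl | rfl | rfl <;> simp [pow_two, hs, ht, e5]
  refine ⟨H, ⟨?_, ?_⟩⟩
  · have : Nat.card H = Set.ncard ({1, s, t, s * t} : Set G) := rfl
    rw [this, Set.ncard_insert_of_notMem, Set.ncard_insert_of_notMem, Set.ncard_pair]
    · simpa using hs1
    · simp [hne, ht1]
    · simp [Ne.symm hs1, Ne.symm ht1, Ne.symm hst1]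
  · refine (Nat.prime_two.eq_one_or_self_of_dvd _
      (Monoid.exponent_dvd_of_forall_pow_eq_one hsq)).resolve_left fun h => ?_
    have := Monoid.exp_eq_one_iff.1 h
    exact hs1 (congrArg Subtype.val (Subsingleton.elim (⟨s, by simp [H]⟩ : H) 1))

end Klein

/-! ### Division algebras, right nuclei and isomorphisms. -/

section NonAssoc

theorem IsDivisionAlg.mul_ne_zero {A : Type*} [NonUnitalNonAssocRing A] (h : IsDivisionAlg A)
    {a b : A} (ha : a ≠ 0) (hb : b ≠ 0) : a * b ≠ 0 := by
  intro h0
  exact hb ((h.2 a ha).1.1 (by simpa using h0))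

theorem isDivisionAlg_of_mul_ne_zero (k : Type*) {A : Type*} [Field k] [NonUnitalNonAssocRing A]
    [Module k A] [IsScalarTower k A A] [SMulCommClass k A A] [FiniteDimensional k A]
    [Nontrivial A] (h : ∀ a b : A, a ≠ 0 → b ≠ 0 → a * b ≠ 0) : IsDivisionAlg A := by
  refine ⟨inferInstance, fun a ha => ⟨?_, ?_⟩⟩
  · have : Function.Injective (LinearMap.mulLeft k a) :=
      (injective_iff_map_eq_zero _).2 fun b hb => by_contra fun hb0 => h a b ha hb0 hb
    exact ⟨this, LinearMap.injective_iff_surjective.1 this⟩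
  · have : Function.Injective (LinearMap.mulRight k a) :=
      (injective_iff_map_eq_zero _).2 fun b hb => by_contra fun hb0 => h b a hb0 ha hb
    exact ⟨this, LinearMap.injective_iff_surjective.1 this⟩

theorem add_mem_rightNucleus {A : Type*} [NonUnitalNonAssocRing A] {z w : A}
    (hz : z ∈ rightNucleus A) (hw : w ∈ rightNucleus A) : z + w ∈ rightNucleus A := by
  intro x y
  rw [mul_add, mul_add, mul_add, hz, hw]

theorem sub_mem_rightNucleus {A : Type*} [NonUnitalNonAssocRing A] {z w : A}
    (hz : z ∈ rightNucleus A) (hw : w ∈ rightNucleus A) : z - w ∈ rightNucleus A := by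
  intro x y
  rw [mul_sub, mul_sub, mul_sub, hz, hw]

theorem mul_mem_rightNucleus {A : Type*} [NonUnitalNonAssocRing A] {z w : A}
    (hz : z ∈ rightNucleus A) (hw : w ∈ rightNucleus A) : z * w ∈ rightNucleus A := by
  intro x y
  rw [← hw, hz, hw, hw]

theorem smul_mem_rightNucleus {k A : Type*} [Field k] [NonUnitalNonAssocRing A] [Module k A]
    [IsScalarTower k A A] [SMulCommClass k A A] (r : k) {z : A}
    (hz : z ∈ rightNucleus A) : r • z ∈ rightNucleus A := by
  intro x y
  rw [mul_smul_comm, mul_smul_comm, mul_smul_comm, hz]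

theorem map_mem_rightNucleus {k A B : Type*} [Field k] [NonUnitalNonAssocRing A] [Module k A]
    [NonUnitalNonAssocRing B] [Module k B] (φ : A ≃ₗ[k] B) (hφ : ∀ x y, φ (x * y) = φ x * φ y)
    {z : A} (hz : z ∈ rightNucleus A) : φ z ∈ rightNucleus B := by
  intro x y
  obtain ⟨x, rfl⟩ := φ.surjective x
  obtain ⟨y, rfl⟩ := φ.surjective y
  rw [← hφ, ← hφ, hz, hφ, hφ]

theorem IsUnity.eq {A : Type*} [Mul A] {e f : A} (he : IsUnity e) (hf : IsUnity f) : e = f := by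
  rw [← (he f).1, (hf e).2]

theorem IsUnity.map {k A B : Type*} [Field k] [NonUnitalNonAssocRing A] [Module k A]
    [NonUnitalNonAssocRing B] [Module k B] (φ : A ≃ₗ[k] B) (hφ : ∀ x y, φ (x * y) = φ x * φ y)
    {e : A} (he : IsUnity e) : IsUnity (φ e) := by
  intro x
  obtain ⟨x, rfl⟩ := φ.surjective x
  rw [← hφ, ← hφ, (he x).1, (he x).2]
  exact ⟨rfl, rfl⟩

section Iso

variable {k A B C : Type*} [Field k] [NonUnitalNonAssocRing A] [Module k A]
  [NonUnitalNonAssocRing B] [Module k B] [NonUnitalNonAssocRing C] [Module k C]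

theorem AlgIsomorphic.symm (h : AlgIsomorphic k A B) : AlgIsomorphic k B A := by
  obtain ⟨φ, hφ⟩ := h
  refine ⟨φ.symm, fun x y => φ.injective ?_⟩
  rw [hφ]
  simp

theorem AlgIsomorphic.trans (h : AlgIsomorphic k A B) (h' : AlgIsomorphic k B C) :
    AlgIsomorphic k A C := by
  obtain ⟨φ, hφ⟩ := h
  obtain ⟨ψ, hψ⟩ := h'
  exact ⟨φ.trans ψ, fun x y => by simp [hφ, hψ]⟩

theorem AlgIsomorphic.assoc (h : AlgIsomorphic k A B)
    (hA : ∀ x y z : A, (x * y) * z = x * (y * z)) (x y z : B) : (x * y) * z = x * (y * z) := by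
  obtain ⟨φ, hφ⟩ := h
  obtain ⟨x, rfl⟩ := φ.surjective x
  obtain ⟨y, rfl⟩ := φ.surjective y
  obtain ⟨z, rfl⟩ := φ.surjective z
  rw [← hφ, ← hφ, hA, hφ, hφ]

end Iso

/-- If `φ` kills some `a ≠ 0`, it kills `a * A = A`. So a non-zero `φ` is injective, and equality of
dimensions makes it bijective. -/
theorem IsC.algIsomorphic_of_ne_zero {k A B : Type*} [Field k] [NonUnitalNonAssocRing A]
    [Module k A] [IsScalarTower k A A] [SMulCommClass k A A] [NonUnitalNonAssocRing B] [Module k B]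
    [IsScalarTower k B B] [SMulCommClass k B B] (hA : IsC k A) (hB : IsC k B) (φ : A →ₙₐ[k] B)
    (hφ : φ ≠ 0) : AlgIsomorphic k A B := by
  have hfA : FiniteDimensional k A := .of_finrank_pos (by rw [hA.1]; omega)
  have hfB : FiniteDimensional k B := .of_finrank_pos (by rw [hB.1]; omega)
  let f : A →ₗ[k] B := { toFun := φ, map_add' := map_add φ, map_smul' := map_smul φ }
  have hf : ∀ a, f a = φ a := fun a => rfl
  have hinj : Function.Injective f := by
    rw [injective_iff_map_eq_zero]
    intro a ha
    by_contra ha0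
    apply hφ
    ext b
    obtain ⟨x, rfl⟩ := (hA.division.2 a ha0).1.2 b
    change φ (a * x) = 0
    rw [map_mul, ← hf a, ha, zero_mul]
  exact ⟨LinearEquiv.ofInjectiveOfFinrankEq f hinj (hA.1.trans hB.1.symm), fun x y => map_mul φ x y⟩

end NonAssoc

/-! ### The algebras `A(ℓ, c)`: division, associativity, centre, isomorphisms. -/

namespace TripleAlg

variable {k ℓ : Type*} [Field k] [Field ℓ] [Algebra k ℓ] {c d : k × k × k}

/-- The element `(x, y)` of `A(ℓ, c)`. -/
def mk (c : k × k × k) (x y : ℓ) : TripleAlg k ℓ c := (x, y)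

omit [Field k] [Field ℓ] [Algebra k ℓ] in
theorem exists_mk (p : TripleAlg k ℓ c) : ∃ x y, p = mk c x y := ⟨p.1, p.2, rfl⟩

omit [Field k] [Field ℓ] [Algebra k ℓ] in
theorem mk_inj {x y x' y' : ℓ} : mk c x y = mk c x' y' ↔ x = x' ∧ y = y' := Prod.mk_inj

theorem zero_def : (0 : TripleAlg k ℓ c) = mk c 0 0 := rfl

theorem mk_add_mk (x y x' y' : ℓ) : mk c x y + mk c x' y' = mk c (x + x') (y + y') := rfl

omit [Field k] [Algebra k ℓ] in
theorem mk_sub_mk (x y x' y' : ℓ) : mk c x y - mk c x' y' = mk c (x - x') (y - y') := rfl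

theorem smul_mk (r : k) (x y : ℓ) : r • mk c x y = mk c (r • x) (r • y) := rfl

theorem mk_mul_mk (x y w z : ℓ) : mk c x y * mk c w z =
    mk c (x * w + (algebraMap k ℓ c.2.1 * y + algebraMap k ℓ c.2.2 * galConj k ℓ y) * z)
      (y * w + (algebraMap k ℓ (1 - c.1) * x + algebraMap k ℓ c.1 * galConj k ℓ x) * z) := rfl

theorem finrank_eq (h2 : Module.finrank k ℓ = 2) : Module.finrank k (TripleAlg k ℓ c) = 4 := by
  have : FiniteDimensional k ℓ := .of_finrank_pos (by omega)
  have h : Module.finrank k (ℓ × ℓ) = 4 := by rw [Module.finrank_prod, h2]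
  exact h

theorem isUnity_mk : IsUnity (mk c (1 : ℓ) 0) := by
  intro p
  obtain ⟨x, y, rfl⟩ := exists_mk p
  simp [mk_mul_mk]

/-- Right multiplication by `(w, 0)` is the scalar action of `w` on `ℓ²`, and the product is
`ℓ`-linear in its right factor. -/
theorem mk_zero_mem_rightNucleus (w : ℓ) : mk c w 0 ∈ rightNucleus (TripleAlg k ℓ c) := by
  intro p q
  obtain ⟨x, y, rfl⟩ := exists_mk p
  obtain ⟨x', y', rfl⟩ := exists_mk q
  simp only [mk_mul_mk, mk_inj]
  constructor <;> ring

/-- The determinant of the matrix in the product `p · q` is `q_c(p)`: a zero of `q_c` makes the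
matrix singular, and a non-zero value makes it invertible by Cramer's rule. -/
theorem isDivisionAlg_iff (h2 : Module.finrank k ℓ = 2) :
    IsDivisionAlg (TripleAlg k ℓ c) ↔ c ∈ admissible k ℓ := by
  have hfin : FiniteDimensional k (TripleAlg k ℓ c) :=
    .of_finrank_pos (by rw [finrank_eq h2]; omega)
  rw [mem_admissible_iff]
  constructor
  · rintro h ⟨x, y⟩ hp
    by_contra h0
    have hp0 : mk c x y ≠ 0 := h0
    -- A kernel vector of the singular matrix is read off from its first row. If that row vanishes,
    -- so does the second column, and `(0, 1)` is in the kernel.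
    by_cases hx : x = 0 ∧ algebraMap k ℓ c.2.1 * y + algebraMap k ℓ c.2.2 * galConj k ℓ y = 0
    · refine h.mul_ne_zero hp0 (b := mk c 0 1) ?_ ?_
      · rw [zero_def, Ne, mk_inj]; simp
      · rw [mk_mul_mk, zero_def, mk_inj, hx.2, hx.1]; simp
    · refine h.mul_ne_zero hp0
        (b := mk c (-(algebraMap k ℓ c.2.1 * y + algebraMap k ℓ c.2.2 * galConj k ℓ y)) x) ?_ ?_
      · rw [zero_def, Ne, mk_inj, neg_eq_zero]; tauto
      · rw [mk_mul_mk, zero_def, mk_inj]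
        rw [qForm] at hp
        exact ⟨by ring, by linear_combination hp⟩
  · intro h
    have : Nontrivial (TripleAlg k ℓ c) := ⟨mk c 1 0, 0, by rw [zero_def, Ne, mk_inj]; simp⟩
    refine isDivisionAlg_of_mul_ne_zero k fun p q hp hq hpq => ?_
    obtain ⟨x, y, rfl⟩ := exists_mk p
    obtain ⟨w, z, rfl⟩ := exists_mk q
    have hp' : qForm k ℓ c (x, y) ≠ 0 := fun h0 => hp (h _ h0)
    rw [mk_mul_mk, zero_def, mk_inj] at hpq
    obtain ⟨h3, h4⟩ := hpq
    have hw : qForm k ℓ c (x, y) * w = 0 := by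
      rw [qForm]
      linear_combination (algebraMap k ℓ (1 - c.1) * x + algebraMap k ℓ c.1 * galConj k ℓ x) * h3 -
        (algebraMap k ℓ c.2.1 * y + algebraMap k ℓ c.2.2 * galConj k ℓ y) * h4
    have hz : qForm k ℓ c (x, y) * z = 0 := by
      rw [qForm]
      linear_combination x * h4 - y * h3
    refine hq ?_
    rw [zero_def, mk_inj]
    exact ⟨(mul_eq_zero.1 hw).resolve_left hp', (mul_eq_zero.1 hz).resolve_left hp'⟩

/-- The conjugation `(x, y) ↦ (x̄, ȳ)` of `A(ℓ, c)`. -/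
noncomputable def conj (c : k × k × k) : TripleAlg k ℓ c ≃ₗ[k] TripleAlg k ℓ c :=
  (galConj k ℓ).toLinearEquiv.prodCongr (galConj k ℓ).toLinearEquiv

theorem conj_mk (x y : ℓ) : conj c (mk c x y) = mk c (galConj k ℓ x) (galConj k ℓ y) := rfl

theorem conj_mul (p q : TripleAlg k ℓ c) : conj c (p * q) = conj c p * conj c q := by
  obtain ⟨x, y, rfl⟩ := exists_mk p
  obtain ⟨w, z, rfl⟩ := exists_mk q
  simp [mk_mul_mk, conj_mk]

/-- The involution `(x, y) ↦ (x, -y)` of `A(ℓ, c)`. -/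
def flip (c : k × k × k) : TripleAlg k ℓ c ≃ₗ[k] TripleAlg k ℓ c :=
  (LinearEquiv.refl k ℓ).prodCongr (LinearEquiv.neg k)

theorem flip_mk (x y : ℓ) : flip c (mk c x y) = mk c x (-y) := rfl

theorem flip_mul (p q : TripleAlg k ℓ c) : flip c (p * q) = flip c p * flip c q := by
  obtain ⟨x, y, rfl⟩ := exists_mk p
  obtain ⟨w, z, rfl⟩ := exists_mk q
  simp only [mk_mul_mk, flip_mk, mk_inj, map_neg]
  constructor <;> ring

theorem algIsomorphic_of_starEquiv (h : StarEquiv k ℓ c d) :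
    AlgIsomorphic k (TripleAlg k ℓ c) (TripleAlg k ℓ d) := by
  obtain ⟨a, ha, h1, h3, h4⟩ := h
  have ha' : galConj k ℓ a ≠ 0 := by simpa using ha
  rw [div_eq_iff (pow_ne_zero 2 ha)] at h3
  rw [div_eq_iff (mul_ne_zero ha ha')] at h4
  -- The isomorphism is `(x, y) ↦ (x, a y)`.
  let φ : TripleAlg k ℓ c ≃ₗ[k] TripleAlg k ℓ d :=
    (LinearEquiv.refl k ℓ).prodCongr ((LinearEquiv.smulOfNeZero ℓ ℓ a ha).restrictScalars k)
  have hφ : ∀ x y, φ (mk c x y) = mk d x (a * y) := fun x y => rfl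
  refine ⟨φ, fun p q => ?_⟩
  obtain ⟨x, y, rfl⟩ := exists_mk p
  obtain ⟨w, z, rfl⟩ := exists_mk q
  simp only [mk_mul_mk, hφ, mk_inj, map_mul, h1]
  exact ⟨by linear_combination (y * z) * h3 + galConj k ℓ y * z * h4, by ring⟩

section Ordered

variable [LinearOrder k] [IsStrictOrderedRing k] {i : ℓ}

theorem isC (h2 : Module.finrank k ℓ = 2) (hi : i ^ 2 = -1) (hc : c ∈ admissible k ℓ) :
    IsC k (TripleAlg k ℓ c) := by
  have hi0 : i ≠ 0 := by rintro rfl; simp at hi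
  have : CharZero ℓ := charZero_of_injective_algebraMap (algebraMap k ℓ).injective
  have hneg : ∀ x : ℓ, x ≠ 0 → -x ≠ x := fun x hx => neg_ne_self.2 hx
  refine ⟨finrank_eq h2, (isDivisionAlg_iff h2).2 hc, ⟨mk c 1 0, isUnity_mk, ?_, ?_⟩, ?_⟩
  · rintro _ ⟨r, rfl⟩
    exact smul_mem_rightNucleus r (mk_zero_mem_rightNucleus 1)
  · intro h
    obtain ⟨r, hr⟩ := h (mk_zero_mem_rightNucleus i)
    simp only [smul_mk, mk_inj, smul_zero, ← Algebra.algebraMap_eq_smul_one] at hr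
    exact algebraMap_ne_of_sq_eq_neg_one hi r hr.1
  · let s : algAut k (TripleAlg k ℓ c) := ⟨conj c, conj_mul⟩
    let t : algAut k (TripleAlg k ℓ c) := ⟨flip c, flip_mul⟩
    refine exists_isKleinFour (s := s) (t := t) ?_ ?_ ?_ ?_ ?_ ?_
    · refine Subtype.ext (LinearEquiv.ext fun p => ?_)
      obtain ⟨x, y, rfl⟩ := exists_mk p
      change conj c (conj c (mk c x y)) = mk c x y
      simp only [conj_mk, galConj_galConj h2 hi]
    · refine Subtype.ext (LinearEquiv.ext fun p => ?_)
      obtain ⟨x, y, rfl⟩ := exists_mk p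
      change flip c (flip c (mk c x y)) = mk c x y
      simp only [flip_mk, neg_neg]
    · refine Subtype.ext (LinearEquiv.ext fun p => ?_)
      obtain ⟨x, y, rfl⟩ := exists_mk p
      change conj c (flip c (mk c x y)) = flip c (conj c (mk c x y))
      simp only [flip_mk, conj_mk, map_neg]
    · intro h
      have : conj c (mk c i 0) = mk c i 0 := LinearEquiv.congr_fun (congrArg Subtype.val h) _
      rw [conj_mk, mk_inj, galConj_sqrt h2 hi] at this
      exact hneg i hi0 this.1
    · intro h
      have : flip c (mk c 0 1) = mk c (0 : ℓ) 1 := LinearEquiv.congr_fun (congrArg Subtype.val h) _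
      rw [flip_mk, mk_inj] at this
      exact hneg 1 one_ne_zero this.2
    · intro h
      have : conj c (mk c i 0) = flip c (mk c i 0) :=
        LinearEquiv.congr_fun (congrArg Subtype.val h) _
      rw [conj_mk, flip_mk, mk_inj, galConj_sqrt h2 hi] at this
      exact hneg i hi0 this.1

/-- Two triples of elements suffice: the first gives `(1 - 2 c₁)² = 1`, where `hc` excludes `c₁ =
0`, and the second then gives `2 c₂ = 0`. -/
theorem assoc_iff (h2 : Module.finrank k ℓ = 2) (hi : i ^ 2 = -1) (hc : 1 / 2 < c.1) :
    (∀ p q r : TripleAlg k ℓ c, (p * q) * r = p * (q * r)) ↔ c.1 = 1 ∧ c.2.1 = 0 := by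
  have hi0 : i ≠ 0 := by rintro rfl; simp at hi
  have : CharZero ℓ := charZero_of_injective_algebraMap (algebraMap k ℓ).injective
  constructor
  · intro h
    have h3 := h (mk c i 0) (mk c i 0) (mk c 0 1)
    have h4 := h (mk c 0 1) (mk c i 0) (mk c 0 1)
    simp only [mk_mul_mk, mk_inj, galConj_sqrt h2 hi, map_add, map_mul, map_zero, map_one, map_neg,
      map_sub, AlgEquiv.commutes] at h3 h4
    have e1 : algebraMap k ℓ (4 * c.1 * (c.1 - 1)) = 0 := by
      simp only [map_sub, map_mul, map_ofNat, map_one]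
      linear_combination 4 * algebraMap k ℓ c.1 * (algebraMap k ℓ c.1 - 1) * hi + h3.2
    have hc1 : c.1 = 1 := by
      rw [map_eq_zero] at e1
      have : c.1 ≠ 0 := by linarith
      have : c.1 - 1 = 0 := by simpa [this] using e1
      linarith
    refine ⟨hc1, ?_⟩
    have e2 : algebraMap k ℓ (2 * c.2.1) = 0 := by
      simp only [map_mul, map_ofNat]
      have h5 := h4.1
      rw [hc1, map_one] at h5
      refine mul_right_cancel₀ hi0 ?_
      linear_combination h5
    simpa using e2
  · rintro ⟨h3, h4⟩ p q r
    obtain ⟨x, y, rfl⟩ := exists_mk p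
    obtain ⟨w, z, rfl⟩ := exists_mk q
    obtain ⟨s, t, rfl⟩ := exists_mk r
    simp only [mk_mul_mk, mk_inj, h3, h4, map_add, map_mul, map_zero, map_one, sub_self,
      AlgEquiv.commutes, galConj_galConj h2 hi]
    constructor <;> ring

/-- Commuting with `(i, 0)` kills the second coordinate, and commuting with `(0, 1)` puts the first
one into `k`. -/
theorem center_eq (h2 : Module.finrank k ℓ = 2) (hi : i ^ 2 = -1) (hc : c.1 = 1 ∧ c.2.1 = 0) :
    {z : TripleAlg k ℓ c | ∀ x, z * x = x * z} = Set.range (fun r : k => r • mk c (1 : ℓ) 0) := by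
  have hi0 : i ≠ 0 := by rintro rfl; simp at hi
  have : CharZero ℓ := charZero_of_injective_algebraMap (algebraMap k ℓ).injective
  ext p
  constructor
  · intro h
    obtain ⟨x, y, rfl⟩ := exists_mk p
    have h3 := h (mk c i 0)
    have h4 := h (mk c 0 1)
    simp only [mk_mul_mk, mk_inj, galConj_sqrt h2 hi, hc.1, sub_self, map_zero, map_one] at h3 h4
    have hy : y = 0 := by
      have : 2 * y * i = 0 := by linear_combination h3.2
      simpa [hi0] using this
    obtain ⟨a, b, rfl⟩ := exists_eq_add_mul_sqrt h2 hi x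
    have hb : algebraMap k ℓ b = 0 := by
      have h5 := h4.2
      rw [galConj_add_mul_sqrt h2 hi] at h5
      have : 2 * algebraMap k ℓ b * i = 0 := by linear_combination -h5
      simpa [hi0] using this
    refine ⟨a, ?_⟩
    change a • mk c 1 0 = _
    rw [smul_mk, mk_inj, hb, hy, Algebra.smul_def]
    simp
  · rintro ⟨r, rfl⟩ x
    simp only [smul_mul_assoc, mul_smul_comm, (isUnity_mk x).1, (isUnity_mk x).2]

-- The right nucleus is closed under sums and products and contains `ℓ × 0`. An element with `y ≠ 0`
-- would bring in `(0, 1)`, hence the whole algebra, which would then be associative.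
omit [LinearOrder k] [IsStrictOrderedRing k] in
theorem mem_rightNucleus_iff (hc : ¬ ∀ p q r : TripleAlg k ℓ c, (p * q) * r = p * (q * r))
    {x y : ℓ} : mk c x y ∈ rightNucleus (TripleAlg k ℓ c) ↔ y = 0 := by
  constructor
  · intro h
    by_contra hy
    have h3 := sub_mem_rightNucleus h (mk_zero_mem_rightNucleus x)
    have h4 := mul_mem_rightNucleus h3 (mk_zero_mem_rightNucleus y⁻¹)
    simp only [mk_sub_mk, mk_mul_mk, sub_self, sub_zero, mul_zero, zero_mul, add_zero,
      mul_inv_cancel₀ hy] at h4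
    refine hc fun p q r => ?_
    obtain ⟨w, z, rfl⟩ := exists_mk r
    have h5 := add_mem_rightNucleus (mk_zero_mem_rightNucleus w)
      (mul_mem_rightNucleus h4 (mk_zero_mem_rightNucleus z))
    simp only [mk_add_mk, mk_mul_mk, mul_zero, zero_mul, add_zero, zero_add, one_mul] at h5
    exact h5 p q
  · rintro rfl
    exact mk_zero_mem_rightNucleus x

/-- Non-associativity identifies both right nuclei with `ℓ`, so the isomorphism sends `i` to `i` or
`-i`. Once it fixes `ℓ`, it is determined by the image `(s, t)` of `(0, 1)`, and `t` is the required
scaling factor. -/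
theorem starEquiv_of_algIsomorphic (h2 : Module.finrank k ℓ = 2) (hi : i ^ 2 = -1)
    (hc : 1 / 2 < c.1) (hc' : ¬ ∀ p q r : TripleAlg k ℓ c, (p * q) * r = p * (q * r))
    (h : AlgIsomorphic k (TripleAlg k ℓ c) (TripleAlg k ℓ d)) : StarEquiv k ℓ c d := by
  have hd' : ¬ ∀ p q r : TripleAlg k ℓ d, (p * q) * r = p * (q * r) :=
    fun h0 => hc' (h.symm.assoc h0)
  have hi0 : i ≠ 0 := by rintro rfl; simp at hi
  have : CharZero ℓ := charZero_of_injective_algebraMap (algebraMap k ℓ).injective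
  -- after composing with the conjugation, the isomorphism fixes `(i, 0)`
  obtain ⟨φ, hφ, hφi⟩ : ∃ φ : TripleAlg k ℓ c ≃ₗ[k] TripleAlg k ℓ d,
      (∀ x y, φ (x * y) = φ x * φ y) ∧ φ (mk c i 0) = mk d i 0 := by
    obtain ⟨φ, hφ⟩ := h
    obtain ⟨x, y, hxy⟩ := exists_mk (φ (mk c i 0))
    have hmem := map_mem_rightNucleus φ hφ (mk_zero_mem_rightNucleus i)
    rw [hxy, mem_rightNucleus_iff hd'] at hmem
    subst hmem
    have h1 : φ (mk c 1 0) = mk d 1 0 := (isUnity_mk.map φ hφ).eq isUnity_mk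
    have h3 : mk c i 0 * mk c i 0 = (-1 : k) • mk c 1 0 := by
      rw [mk_mul_mk, smul_mk, mk_inj]
      simp [← hi, pow_two]
    have h4 := congrArg φ h3
    rw [hφ, hxy, map_smul, h1, mk_mul_mk, smul_mk, mk_inj] at h4
    have h5 : x ^ 2 = i ^ 2 := by rw [hi]; simpa [pow_two] using h4.1
    rcases sq_eq_sq_iff_eq_or_eq_neg.1 h5 with rfl | rfl
    · exact ⟨φ, hφ, hxy⟩
    · refine ⟨φ.trans (conj d), fun x y => ?_, ?_⟩
      · simp only [LinearEquiv.trans_apply, hφ, conj_mul]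
      · rw [LinearEquiv.trans_apply, hxy, conj_mk, map_neg, galConj_sqrt h2 hi, neg_neg, map_zero]
  have h1 : φ (mk c 1 0) = mk d 1 0 := (isUnity_mk.map φ hφ).eq isUnity_mk
  have hφ1 : ∀ x : ℓ, φ (mk c x 0) = mk d x 0 := by
    intro x
    obtain ⟨a, b, rfl⟩ := exists_eq_add_mul_sqrt h2 hi x
    have : ∀ c : k × k × k, mk c (algebraMap k ℓ a + algebraMap k ℓ b * i) 0 =
        a • mk c 1 0 + b • mk c i 0 := by
      intro c
      rw [smul_mk, smul_mk, mk_add_mk, mk_inj]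
      simp [Algebra.smul_def]
    rw [this, this, map_add, map_smul, map_smul, h1, hφi]
  obtain ⟨s, t, hst⟩ := exists_mk (φ (mk c 0 1))
  have hφ2 : ∀ y : ℓ, φ (mk c 0 y) = mk d (s * y) (t * y) := by
    intro y
    rw [show mk c 0 y = mk c 0 1 * mk c y 0 by simp [mk_mul_mk], hφ, hφ1, hst]
    simp [mk_mul_mk]
  have ht : t ≠ 0 := by
    rintro rfl
    have : φ (mk c 0 1) = φ (mk c s 0) := by rw [hst, hφ1]
    have := φ.injective this
    rw [mk_inj] at this
    exact one_ne_zero this.2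
  -- The first product gives `c₁ = d₁` and `s = 0`; the other two give `c₂ + c₃` and `c₂ - c₃` in
  -- terms of `d` and `t`.
  have m1 : φ (mk c i 0 * mk c 0 1) = _ := hφ _ _
  have m2 : φ (mk c 0 1 * mk c 0 1) = _ := hφ _ _
  have m3 : φ (mk c 0 i * mk c 0 1) = _ := hφ _ _
  simp only [mk_mul_mk, map_zero, map_one, mul_zero, zero_mul, add_zero, zero_add, mul_one, hφ1,
    hφ2, mk_inj, galConj_sqrt h2 hi, map_mul] at m1 m2 m3
  have e1 : algebraMap k ℓ c.1 = algebraMap k ℓ d.1 := by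
    have : 2 * i * t * (algebraMap k ℓ c.1 - algebraMap k ℓ d.1) = 0 := by
      simp only [map_sub, map_one] at m1
      linear_combination -m1.2
    rw [mul_eq_zero, sub_eq_zero] at this
    exact this.resolve_left (mul_ne_zero (mul_ne_zero two_ne_zero hi0) ht)
  have hcd : c.1 = d.1 := (algebraMap k ℓ).injective e1
  have hs : s = 0 := by
    have h3 : algebraMap k ℓ (2 * c.1) * i * s = 0 := by
      simp only [map_sub, map_one] at m1
      simp only [map_mul, map_ofNat]
      linear_combination -m1.1
    have h4 : algebraMap k ℓ (2 * c.1) ≠ 0 := (map_ne_zero _).2 (by linarith)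
    simpa only [mul_eq_zero, h4, hi0, false_or] using h3
  subst hs
  have ht' : galConj k ℓ t ≠ 0 := by simpa using ht
  refine ⟨t, ht, hcd, ?_, ?_⟩
  · rw [div_eq_iff (pow_ne_zero 2 ht)]
    refine mul_left_cancel₀ (mul_ne_zero two_ne_zero hi0) ?_
    linear_combination i * m2.1 + m3.1
  · rw [div_eq_iff (mul_ne_zero ht ht')]
    refine mul_left_cancel₀ (mul_ne_zero two_ne_zero hi0) ?_
    linear_combination i * m2.1 - m3.1

end Ordered

end TripleAlg

/-! ### Simultaneous eigenvectors for the four characters. -/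

section Eigenbasis

variable {k A : Type*} [Field k] [CharZero k] [AddCommGroup A] [Module k A] {σ τ : A ≃ₗ[k] A}
  {e u v w : A}

/-- The vectors belong to the four distinct sign patterns of `(σ, τ)`. The signed averages over `1,
σ, τ, στ` project onto each of them, whence the factors `1 / 4`. -/
theorem eq_zero_of_eigen (σe : σ e = e) (τe : τ e = e) (σu : σ u = -u) (τu : τ u = u)
    (σv : σ v = v) (τv : τ v = -v) (σw : σ w = -w) (τw : τ w = -w)
    (he : e ≠ 0) (hu : u ≠ 0) (hv : v ≠ 0) (hw : w ≠ 0) {a b c d : k}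
    (h : a • e + b • u + c • v + d • w = 0) : a = 0 ∧ b = 0 ∧ c = 0 ∧ d = 0 := by
  have h1 := congrArg σ h
  have h2 := congrArg τ h
  have h3 := congrArg (fun x => σ (τ x)) h
  simp only [map_add, map_smul, map_neg, map_zero, σe, τe, σu, τu, σv, τv, σw, τw] at h1 h2 h3
  have ha : a • e = 0 := by linear_combination (norm := module) (1 / 4 : k) • (h + h1 + h2 + h3)
  have hb : b • u = 0 := by linear_combination (norm := module) (1 / 4 : k) • (h - h1 + h2 - h3)
  have hc : c • v = 0 := by linear_combination (norm := module) (1 / 4 : k) • (h + h1 - h2 - h3)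
  have hd : d • w = 0 := by linear_combination (norm := module) (1 / 4 : k) • (h - h1 - h2 + h3)
  exact ⟨(smul_eq_zero.1 ha).resolve_right he, (smul_eq_zero.1 hb).resolve_right hu,
    (smul_eq_zero.1 hc).resolve_right hv, (smul_eq_zero.1 hd).resolve_right hw⟩

theorem exists_eq_sum_eigen (h4 : Module.finrank k A = 4)
    (σe : σ e = e) (τe : τ e = e) (σu : σ u = -u) (τu : τ u = u)
    (σv : σ v = v) (τv : τ v = -v) (σw : σ w = -w) (τw : τ w = -w)
    (he : e ≠ 0) (hu : u ≠ 0) (hv : v ≠ 0) (hw : w ≠ 0) (x : A) :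
    ∃ a b c d : k, x = a • e + b • u + c • v + d • w := by
  have hli : LinearIndependent k ![e, u, v, w] := by
    rw [Fintype.linearIndependent_iff]
    intro g hg
    rw [Fin.sum_univ_four] at hg
    obtain ⟨g0, g1, g2, g3⟩ := eq_zero_of_eigen σe τe σu τu σv τv σw τw he hu hv hw hg
    intro j
    fin_cases j <;> assumption
  have hs := hli.span_eq_top_of_card_eq_finrank (by rw [h4, Fintype.card_fin])
  have hx : x ∈ Submodule.span k (Set.range ![e, u, v, w]) := hs ▸ Submodule.mem_top
  obtain ⟨g, hg⟩ := (Submodule.mem_span_range_iff_exists_fun k).1 hx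
  rw [Fin.sum_univ_four] at hg
  exact ⟨g 0, g 1, g 2, g 3, hg.symm⟩

theorem exists_eq_smul_eigen (h4 : Module.finrank k A = 4)
    (σe : σ e = e) (τe : τ e = e) (σu : σ u = -u) (τu : τ u = u)
    (σv : σ v = v) (τv : τ v = -v) (σw : σ w = -w) (τw : τ w = -w)
    (he : e ≠ 0) (hu : u ≠ 0) (hv : v ≠ 0) (hw : w ≠ 0) (x : A) :
    (σ x = x → τ x = x → ∃ r : k, x = r • e) ∧ (σ x = -x → τ x = x → ∃ r : k, x = r • u) ∧
      (σ x = -x → τ x = -x → ∃ r : k, x = r • w) := by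
  obtain ⟨a, b, c, d, h⟩ := exists_eq_sum_eigen h4 σe τe σu τu σv τv σw τw he hu hv hw x
  have h1 := congrArg σ h
  have h2 := congrArg τ h
  have h3 := congrArg (fun x => σ (τ x)) h
  simp only [map_add, map_smul, map_neg, σe, τe, σu, τu, σv, τv, σw, τw] at h1 h2 h3
  refine ⟨fun σx τx => ⟨a, ?_⟩, fun σx τx => ⟨b, ?_⟩, fun σx τx => ⟨d, ?_⟩⟩
  · simp only [σx, τx] at h1 h2 h3
    linear_combination (norm := module) (1 / 4 : k) • (h + h1 + h2 + h3)
  · simp only [σx, τx] at h1 h2 h3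
    linear_combination (norm := module) (1 / 4 : k) • (h - h1 + h2 - h3)
  · simp only [σx, τx, map_neg] at h1 h2 h3
    linear_combination (norm := module) (1 / 4 : k) • (h - h1 - h2 + h3)

end Eigenbasis

/-! ### Every object of `𝒞(k)` is isomorphic to some `A(ℓ, c)`. -/

section Structure

variable {k A : Type*} [Field k] [LinearOrder k] [IsStrictOrderedRing k] [NonUnitalNonAssocRing A]
  [Module k A] [IsScalarTower k A A] [SMulCommClass k A A] {σ τ : A ≃ₗ[k] A} {e u v : A}

theorem IsUnity.ne_zero (h : IsDivisionAlg A) (he : IsUnity e) : e ≠ 0 := by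
  rintro rfl
  obtain ⟨x, hx⟩ := @exists_ne A h.1 0
  exact hx (by rw [← (he x).1, zero_mul])

omit [LinearOrder k] [IsStrictOrderedRing k] [IsScalarTower k A A] [SMulCommClass k A A] in
theorem IsUnity.fixed (he : IsUnity e) (hσ : ∀ x y, σ (x * y) = σ x * σ y) : σ e = e :=
  (he.map σ hσ).eq he

/-- Sending `i` to `u` embeds `ℓ` into the right nucleus, and `e, u, v, v * u` is an eigenbasis. As
each character has a one-dimensional eigenspace, `u * v`, `v * v` and `(v * u) * v` are multiples
`β`, `γ`, `δ` of `v * u`, `e` and `u`; these fix the product. -/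
theorem exists_algIsomorphic_of_eigen_of_sq {ℓ : Type*} [Field ℓ] [Algebra k ℓ] {i : ℓ}
    (h2 : Module.finrank k ℓ = 2) (hi : i ^ 2 = -1)
    (h4 : Module.finrank k A = 4) (hA : IsDivisionAlg A)
    (he : IsUnity e) (hσ : ∀ x y, σ (x * y) = σ x * σ y) (hτ : ∀ x y, τ (x * y) = τ x * τ y)
    (σu : σ u = -u) (τu : τ u = u) (σv : σ v = v) (τv : τ v = -v) (hv : v ≠ 0)
    (hu : u ∈ rightNucleus A) (huu : u * u = -e) :
    ∃ c : k × k × k, AlgIsomorphic k (TripleAlg k ℓ c) A := by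
  have he0 := he.ne_zero hA
  have hu0 : u ≠ 0 := by rintro rfl; exact he0 (by simpa using huu.symm)
  have hw := hA.mul_ne_zero hv hu0
  have σw : σ (v * u) = -(v * u) := by rw [hσ, σu, σv, mul_neg]
  have τw : τ (v * u) = -(v * u) := by rw [hτ, τu, τv, neg_mul]
  have key := exists_eq_smul_eigen h4 (he.fixed hσ) (he.fixed hτ) σu τu σv τv σw τw he0 hu0 hv hw
  obtain ⟨β, hβ⟩ := (key (u * v)).2.2 (by rw [hσ, σu, σv, neg_mul]) (by rw [hτ, τu, τv, mul_neg])
  obtain ⟨γ, hγ⟩ := (key (v * v)).1 (by rw [hσ, σv]) (by rw [hτ, τv, neg_mul_neg])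
  obtain ⟨δ, hδ⟩ := (key (v * u * v)).2.1 (by rw [hσ, σw, σv, neg_mul])
    (by rw [hτ, τw, τv, neg_mul_neg])
  obtain ⟨f, f1, fi⟩ := exists_linearMap_of_sqrt h2 hi e u
  have hf : ∀ a b : k, f (algebraMap k ℓ a + algebraMap k ℓ b * i) = a • e + b • u := by
    intro a b
    rw [map_add, Algebra.algebraMap_eq_smul_one, map_smul, f1, ← Algebra.smul_def, map_smul, fi]
  have hnuc : ∀ x, f x ∈ rightNucleus A := by
    intro x
    obtain ⟨a, b, rfl⟩ := exists_eq_add_mul_sqrt h2 hi x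
    rw [hf]
    refine add_mem_rightNucleus (smul_mem_rightNucleus a fun x y => ?_) (smul_mem_rightNucleus b hu)
    rw [(he _).2, (he _).2]
  have hfmul : ∀ x y, f (x * y) = f x * f y := by
    intro x y
    obtain ⟨a, b, rfl⟩ := exists_eq_add_mul_sqrt h2 hi x
    obtain ⟨c, d, rfl⟩ := exists_eq_add_mul_sqrt h2 hi y
    rw [show (algebraMap k ℓ a + algebraMap k ℓ b * i) * (algebraMap k ℓ c + algebraMap k ℓ d * i)
      = algebraMap k ℓ (a * c - b * d) + algebraMap k ℓ (a * d + b * c) * i by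
        simp only [map_add, map_sub, map_mul]
        linear_combination (algebraMap k ℓ b * algebraMap k ℓ d) * hi, hf, hf, hf]
    simp only [add_mul, mul_add, smul_mul_assoc, mul_smul_comm, (he _).1, (he _).2, huu]
    module
  -- The solution of `1 - 2 c₁ = β`, `c₂ + c₃ = γ`, `c₂ - c₃ = δ`.
  let c : k × k × k := ((1 - β) / 2, (γ + δ) / 2, (γ - δ) / 2)
  have hleft : ∀ x, f x * v =
      v * f (algebraMap k ℓ (1 - c.1) * x + algebraMap k ℓ c.1 * galConj k ℓ x) := by
    intro x
    obtain ⟨a, b, rfl⟩ := exists_eq_add_mul_sqrt h2 hi x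
    rw [galConj_add_mul_sqrt h2 hi, show ∀ r : k, algebraMap k ℓ (1 - r) *
      (algebraMap k ℓ a + algebraMap k ℓ b * i) + algebraMap k ℓ r *
      (algebraMap k ℓ a - algebraMap k ℓ b * i) = algebraMap k ℓ a +
        algebraMap k ℓ ((1 - 2 * r) * b) * i by
      intro r; simp only [map_sub, map_mul, map_one, map_ofNat]; ring, hf, hf]
    simp only [add_mul, mul_add, smul_mul_assoc, mul_smul_comm, (he _).1, (he _).2, hβ, c]
    module
  have hright : ∀ y, v * f y * v =
      f (algebraMap k ℓ c.2.1 * y + algebraMap k ℓ c.2.2 * galConj k ℓ y) := by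
    intro x
    obtain ⟨a, b, rfl⟩ := exists_eq_add_mul_sqrt h2 hi x
    rw [galConj_add_mul_sqrt h2 hi, show ∀ r s : k, algebraMap k ℓ r *
      (algebraMap k ℓ a + algebraMap k ℓ b * i) + algebraMap k ℓ s *
      (algebraMap k ℓ a - algebraMap k ℓ b * i) = algebraMap k ℓ ((r + s) * a) +
        algebraMap k ℓ ((r - s) * b) * i by
      intro r s; simp only [map_add, map_sub, map_mul]; ring, hf, hf]
    simp only [add_mul, mul_add, smul_mul_assoc, mul_smul_comm, (he _).2, hγ, hδ, c]
    module
  let φ : TripleAlg k ℓ c →ₗ[k] A := f.coprod ((LinearMap.mulLeft k v).comp f)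
  have hφ : ∀ x y, φ (TripleAlg.mk c x y) = f x + v * f y := fun x y => f.coprod_apply _ _
  have hinj : Function.Injective φ := by
    rw [injective_iff_map_eq_zero]
    intro p hp
    obtain ⟨x, y, rfl⟩ := TripleAlg.exists_mk p
    obtain ⟨a, b, rfl⟩ := exists_eq_add_mul_sqrt h2 hi x
    obtain ⟨r, s, rfl⟩ := exists_eq_add_mul_sqrt h2 hi y
    rw [hφ, hf, hf, mul_add, mul_smul_comm, mul_smul_comm, (he _).2, ← add_assoc] at hp
    obtain ⟨rfl, rfl, rfl, rfl⟩ := eq_zero_of_eigen (he.fixed hσ) (he.fixed hτ) σu τu σv τv σw τw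
      he0 hu0 hv hw hp
    simp [TripleAlg.zero_def]
  have : FiniteDimensional k A := .of_finrank_pos (by omega)
  have : FiniteDimensional k (TripleAlg k ℓ c) :=
    .of_finrank_pos (by rw [TripleAlg.finrank_eq h2]; omega)
  refine ⟨c, LinearEquiv.ofInjectiveOfFinrankEq φ hinj ((TripleAlg.finrank_eq h2).trans h4.symm),
    fun p q => ?_⟩
  change φ (p * q) = φ p * φ q
  obtain ⟨x, y, rfl⟩ := TripleAlg.exists_mk p
  obtain ⟨w, z, rfl⟩ := TripleAlg.exists_mk q
  rw [TripleAlg.mk_mul_mk, hφ, hφ, hφ, map_add, map_add, hfmul, hfmul, hfmul, hfmul, ← hright]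
  -- Each reassociation has a right nucleus element `f z` or `f w` as its last factor.
  rw [add_mul, mul_add, mul_add, mul_add, ← hnuc z (f x) v, hleft, hnuc z v, ← hnuc z (v * f y) v,
    hnuc w v]
  abel

/-- By its character `u * u = α • e`. If `α = r ^ 2`, then `u + r • e` and `u - r • e` would be zero
divisors; hence `α < 0`, and `u` can be rescaled to have square `-e`. -/
theorem exists_algIsomorphic_of_eigen {ℓ : Type*} [Field ℓ] [Algebra k ℓ] {i : ℓ}
    (hk : IsSquareOrdered k) (h2 : Module.finrank k ℓ = 2) (hi : i ^ 2 = -1)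
    (h4 : Module.finrank k A = 4) (hA : IsDivisionAlg A)
    (he : IsUnity e) (hσ : ∀ x y, σ (x * y) = σ x * σ y) (hτ : ∀ x y, τ (x * y) = τ x * τ y)
    (σu : σ u = -u) (τu : τ u = u) (hu0 : u ≠ 0) (σv : σ v = v) (τv : τ v = -v) (hv : v ≠ 0)
    (hu : u ∈ rightNucleus A) :
    ∃ c : k × k × k, AlgIsomorphic k (TripleAlg k ℓ c) A := by
  have he0 := he.ne_zero hA
  have hw := hA.mul_ne_zero hv hu0
  have σw : σ (v * u) = -(v * u) := by rw [hσ, σu, σv, mul_neg]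
  have τw : τ (v * u) = -(v * u) := by rw [hτ, τu, τv, neg_mul]
  obtain ⟨α, hα⟩ := (exists_eq_smul_eigen h4 (he.fixed hσ) (he.fixed hτ) σu τu σv τv σw τw he0 hu0
    hv hw (u * u)).1 (by rw [hσ, σu, neg_mul_neg]) (by rw [hτ, τu])
  have hα0 : α < 0 := by
    by_contra! h
    obtain ⟨r, rfl⟩ := hk.exists_sq h
    have hne : ∀ s : k, u + s • e ≠ 0 := by
      intro s h0
      have h1 := congrArg σ h0
      simp only [map_add, map_smul, σu, he.fixed hσ, map_zero] at h1
      exact hu0 (by linear_combination (norm := module) (1 / 2 : k) • (h0 - h1))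
    refine hA.mul_ne_zero (hne r) (hne (-r)) ?_
    simp only [add_mul, mul_add, smul_mul_assoc, mul_smul_comm, (he _).1, (he _).2, hα]
    module
  obtain ⟨r, hr0, hr⟩ := hk.exists_pos_sq (neg_pos.2 hα0)
  refine exists_algIsomorphic_of_eigen_of_sq (u := r⁻¹ • u) h2 hi h4 hA he hσ hτ ?_ ?_ σv τv hv
    (smul_mem_rightNucleus _ hu) ?_
  · rw [map_smul, σu, smul_neg]
  · rw [map_smul, τu]
  · rw [smul_mul_assoc, mul_smul_comm, hα, smul_smul, smul_smul,
      show r⁻¹ * r⁻¹ * α = -1 by field_simp; linear_combination hr]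
    module

-- The vector `y = x - σ x` is negated by `σ`. Either `y + τ y` is non-zero and `τ`-fixed, or `τ`
-- negates `y`.
omit [LinearOrder k] [IsStrictOrderedRing k] [IsScalarTower k A A] [SMulCommClass k A A] in
theorem exists_eigen_of_ne {σ τ : A ≃ₗ[k] A} (σσ : ∀ x, σ (σ x) = x) (ττ : ∀ x, τ (τ x) = x)
    (στ : ∀ x, σ (τ x) = τ (σ x)) (h : ∃ x, σ x ≠ x) :
    (∃ x, x ≠ 0 ∧ σ x = -x ∧ τ x = x) ∨ ∃ x, x ≠ 0 ∧ σ x = -x ∧ τ x = -x := by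
  obtain ⟨x, hx⟩ := h
  have hy : x - σ x ≠ 0 := sub_ne_zero.2 hx.symm
  by_cases h0 : (x - σ x) + τ (x - σ x) = 0
  · exact Or.inr ⟨x - σ x, hy, by simp [σσ], by linear_combination (norm := module) h0⟩
  · refine Or.inl ⟨_, h0, ?_, ?_⟩
    · simp only [map_add, map_sub, σσ, στ]; abel
    · simp only [map_add, map_sub, ττ]; abel

theorem IsC.exists_algIsomorphic {ℓ : Type*} [Field ℓ] [Algebra k ℓ] {i : ℓ}
    (hk : IsSquareOrdered k) (h2' : Module.finrank k ℓ = 2) (hi : i ^ 2 = -1) (hC : IsC k A) :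
    ∃ c : k × k × k, AlgIsomorphic k (TripleAlg k ℓ c) A := by
  obtain ⟨h4, hA, ⟨e, he, hnuc⟩, H, hH⟩ := hC
  have he0 := he.ne_zero hA
  -- two generators of the Klein four-group
  obtain ⟨σ, τ, hσ, hτ, σσ, ττ, στ, σ1, τ1, στ1⟩ : ∃ σ τ : A ≃ₗ[k] A,
      (∀ x y, σ (x * y) = σ x * σ y) ∧ (∀ x y, τ (x * y) = τ x * τ y) ∧
      (∀ x, σ (σ x) = x) ∧ (∀ x, τ (τ x) = x) ∧ (∀ x, σ (τ x) = τ (σ x)) ∧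
      (∃ x, σ x ≠ x) ∧ (∃ x, τ x ≠ x) ∧ ∃ x, σ (τ x) ≠ x := by
    have hsq : ∀ (s : H) (x : A), s.1.1 (s.1.1 x) = x := fun s x =>
      LinearEquiv.congr_fun (congrArg (fun t : H => t.1.1) (IsKleinFour.mul_self s)) x
    have hex : ∀ s : H, s ≠ 1 → ∃ x, s.1.1 x ≠ x := by
      intro s hs
      by_contra! h
      exact hs (Subtype.ext (Subtype.ext (LinearEquiv.ext h)))
    have : Finite H := Nat.finite_of_card_ne_zero (by rw [hH.card_four]; omega)
    obtain ⟨s, hs⟩ : ∃ s : H, s ≠ 1 := by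
      have : Nontrivial H := Finite.one_lt_card_iff_nontrivial.1 (by rw [hH.card_four]; omega)
      exact exists_ne 1
    obtain ⟨t, ht1, hts⟩ : ∃ t : H, t ≠ 1 ∧ t ≠ s := by
      by_contra! h
      have : (Set.univ : Set H) ⊆ {1, s} := fun t _ => by
        by_cases h1 : t = 1
        · simp [h1]
        · simp [h t h1]
      have := Set.ncard_le_ncard this
      rw [Set.ncard_univ, hH.card_four, Set.ncard_pair hs.symm] at this
      omega
    have hcomm : s * t = t * s := (IsKleinFour.isMulCommutative (G := H)).is_comm.comm s t
    refine ⟨s.1.1, t.1.1, s.1.2, t.1.2, hsq s, hsq t, fun x =>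
      LinearEquiv.congr_fun (congrArg (fun t : H => t.1.1) hcomm) x, hex s hs, hex t ht1,
      hex (s * t) fun h => hts ?_⟩
    rw [← mul_right_inj s, h, IsKleinFour.mul_self]
  -- non-zero eigenvectors for the three non-trivial characters
  have c1 := exists_eigen_of_ne σσ ττ στ σ1
  have c2 := exists_eigen_of_ne ττ σσ (fun x => (στ x).symm) τ1
  have c3 := exists_eigen_of_ne (σ := τ.trans σ) (τ := σ)
    (fun x => by simp [στ, σσ, ττ]) σσ (fun x => by simp [στ]) στ1
  simp only [LinearEquiv.trans_apply] at c3
  -- Each non-trivial character is trivial on one of `σ`, `τ`, `στ`, so `c1`, `c2`, `c3` together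
  -- produce at least two of the three characters. The remaining one comes from a product of
  -- eigenvectors, non-zero in a division algebra.
  obtain ⟨u, v, w, hu, hv, hw, σu, τu, σv, τv, σw, τw⟩ : ∃ u v w : A, u ≠ 0 ∧ v ≠ 0 ∧ w ≠ 0 ∧
      σ u = -u ∧ τ u = u ∧ σ v = v ∧ τ v = -v ∧ σ w = -w ∧ τ w = -w := by
    have case1 : (∃ x, x ≠ 0 ∧ σ x = -x ∧ τ x = x) → (∃ x, x ≠ 0 ∧ σ x = x ∧ τ x = -x) →
        ∃ u v w : A, u ≠ 0 ∧ v ≠ 0 ∧ w ≠ 0 ∧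
          σ u = -u ∧ τ u = u ∧ σ v = v ∧ τ v = -v ∧ σ w = -w ∧ τ w = -w := by
      rintro ⟨u, hu, σu, τu⟩ ⟨v, hv, σv, τv⟩
      exact ⟨u, v, u * v, hu, hv, hA.mul_ne_zero hu hv, σu, τu, σv, τv, by rw [hσ, σu, σv, neg_mul],
        by rw [hτ, τu, τv, mul_neg]⟩
    have hV : (∃ x, x ≠ 0 ∧ σ (τ x) = -x ∧ σ x = x) → ∃ x, x ≠ 0 ∧ σ x = x ∧ τ x = -x := by
      rintro ⟨x, hx, h1, h3⟩
      exact ⟨x, hx, h3, by rw [← h1, στ, h3]⟩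
    have hU : (∃ x, x ≠ 0 ∧ σ (τ x) = -x ∧ σ x = -x) → ∃ x, x ≠ 0 ∧ σ x = -x ∧ τ x = x := by
      rintro ⟨x, hx, h1, h3⟩
      exact ⟨x, hx, h3, by rw [στ, h3, map_neg, neg_inj] at h1; exact h1⟩
    have c3 := c3.imp hV hU
    rcases c3 with h3 | h3
    · rcases c1 with h1 | h1
      · exact case1 h1 h3
      · refine case1 ?_ h3
        obtain ⟨w, hw, σw, τw⟩ := h1
        obtain ⟨v, hv, σv, τv⟩ := h3
        exact ⟨w * v, hA.mul_ne_zero hw hv, by rw [hσ, σw, σv, neg_mul],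
          by rw [hτ, τw, τv, neg_mul_neg]⟩
    · rcases c2 with ⟨v, hv, τv, σv⟩ | ⟨w, hw, τw, σw⟩
      · exact case1 h3 ⟨v, hv, σv, τv⟩
      · refine case1 h3 ?_
        obtain ⟨u, hu, σu, τu⟩ := h3
        exact ⟨w * u, hA.mul_ne_zero hw hu, by rw [hσ, σw, σu, neg_mul_neg],
          by rw [hτ, τw, τu, neg_mul]⟩
  -- one of these eigenvectors lies in the right nucleus
  obtain ⟨z, hz, hze⟩ := Set.exists_of_ssubset hnuc
  obtain ⟨a, b, c, d, h⟩ := exists_eq_sum_eigen h4 (he.fixed hσ) (he.fixed hτ) σu τu σv τv σw τw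
    he0 hu hv hw z
  -- Automorphisms preserve the right nucleus, so it contains all character components of `z`. As
  -- `z` is not in `k e`, one of `b`, `c`, `d` is non-zero.
  have zσ := map_mem_rightNucleus σ hσ hz
  have zτ := map_mem_rightNucleus τ hτ hz
  have zστ := map_mem_rightNucleus σ hσ zτ
  have h1 := congrArg σ h
  have h2 := congrArg τ h
  have h3 := congrArg (fun x => σ (τ x)) h
  simp only [map_add, map_smul, map_neg, he.fixed hσ, he.fixed hτ, σu, τu, σv, τv, σw, τw]
    at h1 h2 h3
  have mem_of_smul : ∀ {r : k} {x : A}, r ≠ 0 → r • x ∈ rightNucleus A → x ∈ rightNucleus A := by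
    intro r x hr hx
    simpa [smul_smul, inv_mul_cancel₀ hr] using smul_mem_rightNucleus r⁻¹ hx
  by_cases hb : b = 0
  · by_cases hc : c = 0
    · by_cases hd : d = 0
      · exact absurd ⟨a, by simp [h, hb, hc, hd]⟩ hze
      · have hwn : w ∈ rightNucleus A := by
          refine mem_of_smul (r := 4 * d) (by simpa using hd) ?_
          rw [show (4 * d) • w = (z - σ z) + (σ (τ z) - τ z) by
            linear_combination (norm := module) -(h - h1 - h2 + h3)]
          exact add_mem_rightNucleus (sub_mem_rightNucleus hz zσ) (sub_mem_rightNucleus zστ zτ)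
        -- Replacing `τ` by `στ` gives `w` the signs required of `u` and keeps those of `v`.
        exact exists_algIsomorphic_of_eigen (σ := σ) (τ := τ.trans σ) hk h2' hi h4 hA he hσ
          (fun x y => by simp [hσ, hτ]) σw (by simp [σw, τw]) hw σv (by simp [σv, τv]) hv hwn
    · have hvn : v ∈ rightNucleus A := by
        refine mem_of_smul (r := 4 * c) (by simpa using hc) ?_
        rw [show (4 * c) • v = (z - τ z) + (σ z - σ (τ z)) by
          linear_combination (norm := module) -(h + h1 - h2 - h3)]
        exact add_mem_rightNucleus (sub_mem_rightNucleus hz zτ) (sub_mem_rightNucleus zσ zστ)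
      exact exists_algIsomorphic_of_eigen (σ := τ) (τ := σ) hk h2' hi h4 hA he hτ hσ τv σv hv τu σu
        hu hvn
  · have hun : u ∈ rightNucleus A := by
      refine mem_of_smul (r := 4 * b) (by simpa using hb) ?_
      rw [show (4 * b) • u = (z - σ z) + (τ z - σ (τ z)) by
        linear_combination (norm := module) -(h - h1 + h2 - h3)]
      exact add_mem_rightNucleus (sub_mem_rightNucleus hz zσ) (sub_mem_rightNucleus zτ zστ)
    exact exists_algIsomorphic_of_eigen (σ := σ) (τ := τ) hk h2' hi h4 hA he hσ hτ σu τu hu σv τv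
      hv hun

end Structure

/-! ### Normal forms for `ℓ*`-equivalence. -/

section Transversal

variable {k : Type*} [Field k] [LinearOrder k] [IsStrictOrderedRing k] {ℓ : Type*} [Field ℓ]
  [Algebra k ℓ] {i : ℓ} {c d : k × k × k}

theorem mem_admissibleN_iff (hk : IsSquareOrdered k) (h2 : Module.finrank k ℓ = 2)
    (hi : i ^ 2 = -1) : c ∈ admissibleN k ℓ ↔
      (1 / 2 < c.1 ∧ c.2.2 < c.2.1 ∧ c.2.1 < -c.2.2) ∧ ¬ (c.1 = 1 ∧ c.2.1 = 0) := by
  rw [← hk.mem_admissible_iff_lt h2 hi]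
  constructor
  · rintro ⟨h, h'⟩
    refine ⟨h, fun h0 => h'.2 ?_⟩
    rwa [TripleAlg.assoc_iff h2 hi ((hk.mem_admissible_iff_lt h2 hi).1 h).1]
  · rintro ⟨h, h'⟩
    refine ⟨h, TripleAlg.isC h2 hi h, ?_⟩
    rwa [TripleAlg.assoc_iff h2 hi ((hk.mem_admissible_iff_lt h2 hi).1 h).1]

theorem mem_admissibleN0_iff (hk : IsSquareOrdered k) (h2 : Module.finrank k ℓ = 2)
    (hi : i ^ 2 = -1) : c ∈ admissibleN0 k ℓ ↔
      1 / 2 < c.1 ∧ c.2.1 = 0 ∧ c.2.2 < 0 ∧ c.1 ≠ 1 := by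
  change c ∈ admissibleN k ℓ ∧ c.2.1 = 0 ↔ _
  rw [mem_admissibleN_iff hk h2 hi]
  constructor
  · rintro ⟨⟨⟨h1, h3, h4⟩, h5⟩, h6⟩
    exact ⟨h1, h6, by linarith, fun h => h5 ⟨h, h6⟩⟩
  · rintro ⟨h1, h3, h4, h5⟩
    exact ⟨⟨⟨h1, by linarith, by linarith⟩, fun h => h5 h.1⟩, h3⟩

theorem mem_admissibleN1_iff (hk : IsSquareOrdered k) (h2 : Module.finrank k ℓ = 2)
    (hi : i ^ 2 = -1) : c ∈ admissibleN1 k ℓ ↔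
      1 / 2 < c.1 ∧ c.2.2 < c.2.1 ∧ c.2.1 < -c.2.2 ∧ c.2.1 ≠ 0 := by
  change c ∈ admissibleN k ℓ ∧ c.2.1 ≠ 0 ↔ _
  rw [mem_admissibleN_iff hk h2 hi]
  tauto

omit [LinearOrder k] [IsStrictOrderedRing k] in
theorem StarEquiv.snd_fst_eq_zero_iff (h : StarEquiv k ℓ c d) : c.2.1 = 0 ↔ d.2.1 = 0 := by
  obtain ⟨a, ha, -, h, -⟩ := h
  rw [← map_eq_zero (algebraMap k ℓ), ← map_eq_zero (algebraMap k ℓ) (a := d.2.1), ← h,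
    div_eq_zero_iff, or_iff_left (pow_ne_zero 2 ha)]

-- The vanishing of `c₂` is invariant, so the two normal forms do not mix. If both middle entries
-- are `1`, then `a = ±1` has norm `1` and `c₃` is unchanged.
omit [LinearOrder k] [IsStrictOrderedRing k] in
theorem StarEquiv.eq_of_normalized (h : StarEquiv k ℓ c d)
    (hc : c.2.1 = 0 ∧ c.2.2 = -1 ∨ c.2.1 = 1) (hd : d.2.1 = 0 ∧ d.2.2 = -1 ∨ d.2.1 = 1) :
    c = d := by
  have hz := h.snd_fst_eq_zero_iff
  obtain ⟨a, ha, h1, h2, h3⟩ := h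
  rcases hc with ⟨c2, c3⟩ | c2
  · rcases hd with ⟨d2, d3⟩ | d2
    · exact Prod.ext h1 (Prod.ext (c2.trans d2.symm) (c3.trans d3.symm))
    · rw [d2] at hz; exact absurd (hz.1 c2) one_ne_zero
  · rcases hd with ⟨d2, d3⟩ | d2
    · rw [c2] at hz; exact absurd (hz.2 d2) one_ne_zero
    · refine Prod.ext h1 (Prod.ext (c2.trans d2.symm) ((algebraMap k ℓ).injective ?_))
      rw [c2, d2, map_one, div_eq_one_iff_eq (pow_ne_zero 2 ha), eq_comm, ← one_pow 2, sq_eq_sq_iff_eq_or_eq_neg]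
        at h2
      rw [← h3]
      rcases h2 with rfl | rfl <;> simp

theorem exists_starEquiv_normalized (hk : IsSquareOrdered k) (h2 : Module.finrank k ℓ = 2)
    (hi : i ^ 2 = -1) (h3 : c.2.2 < c.2.1) (h4 : c.2.1 < -c.2.2) :
    ∃ d : k × k × k, StarEquiv k ℓ c d ∧ d.1 = c.1 ∧
      (c.2.1 = 0 ∧ d.2.1 = 0 ∧ d.2.2 = -1 ∨ c.2.1 ≠ 0 ∧ d.2.1 = 1 ∧ d.2.2 < -1) := by
  have hi0 : i ≠ 0 := by rintro rfl; simp at hi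
  rcases lt_trichotomy c.2.1 0 with h | h | h
  · obtain ⟨r, hr0, hr⟩ := hk.exists_pos_sq (neg_pos.2 h)
    have hrl : algebraMap k ℓ r ≠ 0 := (map_ne_zero _).2 hr0.ne'
    have hr' := congrArg (algebraMap k ℓ) hr
    simp only [map_pow, map_neg] at hr'
    -- For `c₂ < 0` the scaling factor is `a = r i`, with `a² = c₂` and norm `-c₂`; thus the bound
    -- `c₃ < c₂` becomes `c₃ / -c₂ < -1`.
    refine ⟨(c.1, 1, c.2.2 / -c.2.1), ⟨algebraMap k ℓ r * i, mul_ne_zero hrl hi0, rfl, ?_, ?_⟩, rfl,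
      Or.inr ⟨h.ne, rfl, ?_⟩⟩
    · rw [map_one, div_eq_one_iff_eq (pow_ne_zero 2 (mul_ne_zero hrl hi0)), mul_pow, hr', hi]
      ring
    · rw [map_mul, galConj_sqrt h2 hi, AlgEquiv.commutes, map_div₀, map_neg, ← hr']
      congr 1
      linear_combination -algebraMap k ℓ r ^ 2 * hi
    · change c.2.2 / -c.2.1 < -1
      rw [div_lt_iff₀ (by linarith)]
      linarith
  · obtain ⟨r, hr0, hr⟩ := hk.exists_pos_sq (x := -c.2.2) (by linarith)
    have hrl : algebraMap k ℓ r ≠ 0 := (map_ne_zero _).2 hr0.ne'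
    have hr' := congrArg (algebraMap k ℓ) hr
    simp only [map_pow, map_neg] at hr'
    refine ⟨(c.1, 0, -1), ⟨algebraMap k ℓ r, hrl, rfl, ?_, ?_⟩, rfl, Or.inl ⟨h, rfl, rfl⟩⟩
    · simp [h]
    · rw [AlgEquiv.commutes, div_eq_iff (mul_ne_zero hrl hrl), map_neg, map_one]
      linear_combination hr'
  · obtain ⟨r, hr0, hr⟩ := hk.exists_pos_sq h
    have hrl : algebraMap k ℓ r ≠ 0 := (map_ne_zero _).2 hr0.ne'
    have hr' := congrArg (algebraMap k ℓ) hr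
    simp only [map_pow] at hr'
    refine ⟨(c.1, 1, c.2.2 / c.2.1), ⟨algebraMap k ℓ r, hrl, rfl, ?_, ?_⟩, rfl,
      Or.inr ⟨h.ne', rfl, ?_⟩⟩
    · rw [map_one, div_eq_one_iff_eq (pow_ne_zero 2 hrl), hr']
    · rw [AlgEquiv.commutes, map_div₀, ← hr', pow_two]
    · change c.2.2 / c.2.1 < -1
      rw [div_lt_iff₀ h]
      linarith

theorem isStarTransversal_transversalN0 (hk : IsSquareOrdered k) (h2 : Module.finrank k ℓ = 2)
    (hi : i ^ 2 = -1) : IsStarTransversal k ℓ (admissibleN0 k ℓ) (transversalN0 k) := by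
  refine ⟨?_, fun c hc => ?_⟩
  · rintro c ⟨h1, h3, h4, h5⟩
    rw [mem_admissibleN0_iff hk h2 hi]
    exact ⟨h1, h4, by rw [h5]; linarith, h3⟩
  · obtain ⟨h1, h3, h4, h5⟩ := (mem_admissibleN0_iff hk h2 hi).1 hc
    obtain ⟨d, hcd, hd1, hd⟩ := exists_starEquiv_normalized hk h2 hi (c := c) (by linarith)
      (by linarith)
    have hd := hd.resolve_right fun h => h.1 h3
    refine ⟨d, ⟨⟨by rwa [hd1], by rwa [hd1], hd.2⟩, hcd⟩, ?_⟩
    rintro t ⟨⟨-, -, ht⟩, hct⟩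
    have e := starEquiv_equivalence k ℓ
    exact (e.trans (e.symm hct) hcd).eq_of_normalized (Or.inl ht) (Or.inl hd.2)

theorem isStarTransversal_transversalN1 (hk : IsSquareOrdered k) (h2 : Module.finrank k ℓ = 2)
    (hi : i ^ 2 = -1) : IsStarTransversal k ℓ (admissibleN1 k ℓ) (transversalN1 k) := by
  refine ⟨?_, fun c hc => ?_⟩
  · rintro c ⟨h1, h3, h4⟩
    rw [mem_admissibleN1_iff hk h2 hi, h3]
    exact ⟨h1, by linarith, by linarith, one_ne_zero⟩
  · obtain ⟨h1, h3, h4, h5⟩ := (mem_admissibleN1_iff hk h2 hi).1 hc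
    obtain ⟨d, hcd, hd1, hd⟩ := exists_starEquiv_normalized hk h2 hi h3 h4
    have hd := hd.resolve_left fun h => h5 h.1
    refine ⟨d, ⟨⟨by rwa [hd1], hd.2⟩, hcd⟩, ?_⟩
    rintro t ⟨⟨-, ht, -⟩, hct⟩
    have e := starEquiv_equivalence k ℓ
    exact (e.trans (e.symm hct) hcd).eq_of_normalized (Or.inr ht) (Or.inr hd.2.1)

omit [IsStrictOrderedRing k] in
theorem disjoint_transversal : Disjoint (transversalN0 k) (transversalN1 k) := by
  rw [Set.disjoint_left]
  rintro c ⟨-, -, h, -⟩ ⟨-, h', -⟩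
  exact zero_ne_one (h.symm.trans h')

omit [LinearOrder k] [IsStrictOrderedRing k] in
/-- Transversals for two subsets that are separated by an `ℓ*`-invariant property unite to a
transversal. -/
theorem IsStarTransversal.union {C T₀ T₁ : Set (k × k × k)}
    (h₀ : IsStarTransversal k ℓ {c | c ∈ C ∧ c.2.1 = 0} T₀)
    (h₁ : IsStarTransversal k ℓ {c | c ∈ C ∧ c.2.1 ≠ 0} T₁) :
    IsStarTransversal k ℓ C (T₀ ∪ T₁) := by
  refine ⟨Set.union_subset (fun c hc => (h₀.1 hc).1) (fun c hc => (h₁.1 hc).1), fun c hc => ?_⟩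
  by_cases h : c.2.1 = 0
  · obtain ⟨t, ⟨ht, hct⟩, hu⟩ := h₀.2 c ⟨hc, h⟩
    refine ⟨t, ⟨Or.inl ht, hct⟩, ?_⟩
    rintro s ⟨hs | hs, hcs⟩
    · exact hu s ⟨hs, hcs⟩
    · exact absurd (hcs.snd_fst_eq_zero_iff.1 h) (h₁.1 hs).2
  · obtain ⟨t, ⟨ht, hct⟩, hu⟩ := h₁.2 c ⟨hc, h⟩
    refine ⟨t, ⟨Or.inr ht, hct⟩, ?_⟩
    rintro s ⟨hs | hs, hcs⟩
    · exact absurd (hcs.snd_fst_eq_zero_iff.2 (h₀.1 hs).2) h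
    · exact hu s ⟨hs, hcs⟩

omit [IsStrictOrderedRing k] in
theorem one_zero_neg_one_notMem : ((1, 0, -1) : k × k × k) ∉ transversalN0 k ∪ transversalN1 k := by
  rintro (⟨-, h, -⟩ | ⟨-, h, -⟩)
  · exact h rfl
  · exact zero_ne_one h

end Transversal

/-! ### Classification of `𝒞(k)` and its splitting. -/

section Classification

variable {k : Type u} [Field k] [LinearOrder k] [IsStrictOrderedRing k] {ℓ : Type w} [Field ℓ]
  [Algebra k ℓ] {i : ℓ}

theorem classifiesC (hk : IsSquareOrdered k) (h2 : Module.finrank k ℓ = 2) (hi : i ^ 2 = -1) :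
    ClassifiesC.{v} k ℓ ((transversalN0 k ∪ transversalN1 k) ∪ {(1, 0, -1)}) := by
  have hT : ∀ c ∈ (transversalN0 k ∪ transversalN1 k) ∪ {((1, 0, -1) : k × k × k)},
      (1 / 2 < c.1 ∧ c.2.2 < c.2.1 ∧ c.2.1 < -c.2.2) ∧
        (c.2.1 = 0 ∧ c.2.2 = -1 ∨ c.2.1 = 1) := by
    rintro c ((⟨h1, -, h3, h4⟩ | ⟨h1, h3, h4⟩) | rfl)
    · rw [h3, h4]
      exact ⟨⟨h1, by norm_num, by norm_num⟩, Or.inl ⟨rfl, rfl⟩⟩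
    · rw [h3]
      exact ⟨⟨h1, by linarith, by linarith⟩, Or.inr rfl⟩
    · exact ⟨⟨by norm_num, by norm_num, by norm_num⟩, Or.inl ⟨rfl, rfl⟩⟩
  refine ⟨fun c hc => ?_, fun c hc d hd h => ?_, ?_⟩
  · exact TripleAlg.isC h2 hi ((hk.mem_admissible_iff_lt h2 hi).2 (hT c hc).1)
  · obtain ⟨hc, hc'⟩ := hT c hc
    obtain ⟨hd, hd'⟩ := hT d hd
    -- In the associative case the right nucleus is everything and gives no information, but
    -- associativity and normalization force `c = d = (1, 0, -1)`.
    by_cases ha : ∀ p q r : TripleAlg k ℓ c, (p * q) * r = p * (q * r)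
    · have hb := h.assoc ha
      rw [TripleAlg.assoc_iff h2 hi hc.1] at ha
      rw [TripleAlg.assoc_iff h2 hi hd.1] at hb
      have c3 : c.2.2 = -1 := by simpa [ha.2] using hc'
      have d3 : d.2.2 = -1 := by simpa [hb.2] using hd'
      exact Prod.ext (ha.1.trans hb.1.symm) (Prod.ext (ha.2.trans hb.2.symm) (c3.trans d3.symm))
    · exact (TripleAlg.starEquiv_of_algIsomorphic h2 hi hc.1 ha h).eq_of_normalized hc' hd'
  · intro A _ _ _ _ hA
    obtain ⟨c, hc⟩ := hA.exists_algIsomorphic hk h2 hi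
    have hdiv : IsDivisionAlg (TripleAlg k ℓ c) := by
      obtain ⟨φ, hφ⟩ := hc
      have : FiniteDimensional k (TripleAlg k ℓ c) :=
        .of_finrank_pos (by rw [TripleAlg.finrank_eq h2]; omega)
      have : Nontrivial A := hA.division.1
      have : Nontrivial (TripleAlg k ℓ c) := φ.toEquiv.nontrivial
      refine isDivisionAlg_of_mul_ne_zero k fun a b ha hb h0 => ?_
      refine hA.division.mul_ne_zero (φ.map_ne_zero_iff.2 ha) (φ.map_ne_zero_iff.2 hb) ?_
      rw [← hφ, h0, map_zero]
    rw [TripleAlg.isDivisionAlg_iff h2, hk.mem_admissible_iff_lt h2 hi] at hdiv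
    obtain ⟨h1, h3, h4⟩ := hdiv
    obtain ⟨d, hcd, hd1, hd⟩ := exists_starEquiv_normalized hk h2 hi h3 h4
    refine ⟨d, ?_, (TripleAlg.algIsomorphic_of_starEquiv hcd).symm.trans hc⟩
    rw [← hd1] at h1
    rcases hd with ⟨-, hd⟩ | ⟨-, hd⟩
    · by_cases hd1' : d.1 = 1
      · exact Or.inr (Prod.ext hd1' (Prod.ext hd.1 hd.2))
      · exact Or.inl (Or.inl ⟨h1, hd1', hd⟩)
    · exact Or.inl (Or.inr ⟨h1, hd⟩)

/-- By the classification, the centre can be computed in `A(ℓ, c)` with `c₁ = 1`, `c₂ = 0` and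
transported along the isomorphism. -/
theorem IsC.isS_of_assoc (hk : IsSquareOrdered k) (h2 : Module.finrank k ℓ = 2) (hi : i ^ 2 = -1)
    {A : Type v} [NonUnitalNonAssocRing A] [Module k A] [IsScalarTower k A A]
    [SMulCommClass k A A] (hA : IsC k A) (h : ∀ x y z : A, (x * y) * z = x * (y * z)) :
    IsS k A := by
  obtain ⟨c, hc, hiso⟩ := (classifiesC hk h2 hi).2.2 A hA
  have hc1 : 1 / 2 < c.1 := by
    rcases hc with (hc | hc) | rfl
    · exact hc.1
    · exact hc.1
    · norm_num
  have hass := (TripleAlg.assoc_iff h2 hi hc1).1 (hiso.symm.assoc h)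
  have hcen := TripleAlg.center_eq h2 hi hass
  obtain ⟨φ, hφ⟩ := hiso
  refine ⟨hA, h, φ (TripleAlg.mk c 1 0), TripleAlg.isUnity_mk.map φ hφ, ?_⟩
  ext z
  obtain ⟨z, rfl⟩ := φ.surjective z
  have : z ∈ {z : TripleAlg k ℓ c | ∀ x, z * x = x * z} ↔ φ z ∈ {z : A | ∀ x, z * x = x * z} := by
    refine ⟨fun hz x => ?_, fun hz x => φ.injective ?_⟩
    · obtain ⟨x, rfl⟩ := φ.surjective x
      rw [← hφ, hz, hφ]
    · rw [hφ, hz, hφ]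
  rw [← this, hcen]
  simp only [Set.mem_range, ← map_smul, φ.injective.eq_iff]

theorem cEqNCoprodS (hk : IsSquareOrdered k) (h2 : Module.finrank k ℓ = 2) (hi : i ^ 2 = -1) :
    CEqNCoprodS.{v} k := by
  refine ⟨fun A _ _ _ _ => ⟨fun hA => ⟨?_, fun h => h.1.2 h.2.2.1⟩, ?_⟩,
    fun A B _ _ _ _ _ _ _ _ hA hB => ⟨fun φ => ?_, fun φ => ?_⟩⟩
  · by_cases h : ∀ x y z : A, (x * y) * z = x * (y * z)
    · exact Or.inr (hA.isS_of_assoc hk h2 hi h)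
    · exact Or.inl ⟨hA, h⟩
  · rintro ⟨h | h, -⟩
    · exact h.1
    · exact h.1
  · by_contra h
    exact hA.2 ((hA.1.algIsomorphic_of_ne_zero hB.1 φ h).symm.assoc hB.2.1)
  · by_contra h
    exact hA.2 ((hB.1.algIsomorphic_of_ne_zero hA.1 φ h).assoc hB.2.1)

end Classification


theorem corollary5p10 (k : Type u) [Field k] [LinearOrder k] [IsStrictOrderedRing k]
    (hk : IsSquareOrdered k) (ℓ : Type w) [Field ℓ] [Algebra k ℓ] (i : ℓ) (hi : i ^ 2 = -1)
    (hℓ : IntermediateField.adjoin k {i} = ⊤) :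
    -- the field `ℓ` represents the unique quadratic extension class of `k`
    HasUniqueQuadraticExtensionClass.{v} k ℓ ∧
    -- the norm morphism is not surjective, and `-1` is not a norm
    (normImage k ℓ ≠ {r : k | r ≠ 0} ∧ (-1 : k) ∉ normImage k ℓ) ∧
    -- display of the admissible triples
    admissible k ℓ = {c | 1 / 2 < c.1 ∧ c.2.2 < c.2.1 ∧ c.2.1 < -c.2.2} ∧
    -- display of the admissible triples with non-associative algebra, with `c₂ = 0` and `c₂ ≠ 0`
    admissibleN0 k ℓ = {c | 1 / 2 < c.1 ∧ c.2.1 = 0 ∧ c.2.2 < 0 ∧ c.1 ≠ 1} ∧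
    admissibleN1 k ℓ = {c | 1 / 2 < c.1 ∧ c.2.2 < c.2.1 ∧ c.2.1 < -c.2.2 ∧ c.2.1 ≠ 0} ∧
    -- transversals
    IsStarTransversal k ℓ (admissibleN0 k ℓ) (transversalN0 k) ∧
    IsStarTransversal k ℓ (admissibleN1 k ℓ) (transversalN1 k) ∧
    Disjoint (transversalN0 k) (transversalN1 k) ∧
    IsStarTransversal k ℓ (admissibleN k ℓ) (transversalN0 k ∪ transversalN1 k) ∧
    -- the classification
    (1, 0, -1) ∉ transversalN0 k ∪ transversalN1 k ∧
    ClassifiesC.{v} k ℓ ((transversalN0 k ∪ transversalN1 k) ∪ {(1, 0, -1)}) ∧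
    CEqNCoprodS.{v} k := by
  have h2 := finrank_eq_two_of_adjoin_sqrt hi hℓ
  refine ⟨hasUniqueQuadraticExtensionClass_of_sqrt hk h2 hi,
    ⟨fun h => neg_one_notMem_normImage h2 hi ?_, neg_one_notMem_normImage h2 hi⟩,
    Set.ext fun c => hk.mem_admissible_iff_lt h2 hi, Set.ext fun c => mem_admissibleN0_iff hk h2 hi,
    Set.ext fun c => mem_admissibleN1_iff hk h2 hi, isStarTransversal_transversalN0 hk h2 hi,
    isStarTransversal_transversalN1 hk h2 hi, disjoint_transversal,
    (isStarTransversal_transversalN0 hk h2 hi).union (isStarTransversal_transversalN1 hk h2 hi),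
    one_zero_neg_one_notMem, classifiesC hk h2 hi, cEqNCoprodS hk h2 hi⟩
  rw [h]
  exact neg_ne_zero.2 one_ne_zero
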